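/- A (bivariate) copula is a function $C\colon[0,1]^2\to[0,1]$ with $C(u,0)=0=C(0,u)$ and $C(u,1)=u=C(1,u)$ for all $u$, and $C(u,v)+C(u',v')-C(u,v')-C(u',v)\ge 0$ for all $u\le u'$, $v\le v'$. Let $\mathcal C$ be the set of all copulas, and for $C\in\mathcal C$ let \[ \xi(C)=6\int_0^1\!\!\int_0^1\bigl(\partial_1 C(t,v)\bigr)^2\,dt\,dv-2,\qquad \rho(C)=12\int_{[0,1]^2}C(u,v)\,d\lambda^2(u,v)-3 \] be Chatterjee's xi and Spearman's rho (for each $v$, the derivative $\partial_1C(t,v)$ exists for almost every $t$). Put \[ b_x=\begin{cases}\dfrac{\sqrt{6x}}{2\cos\left(\frac13\arccos\left(-\frac{3\sqrt{6x}}5\right)\right)},&0<x\le\frac3{10},\\[2ex]\dfrac{5+\sqrt{5(6x-1)}}{10(1-x)},&\frac3{10}<x<1,\end{cases} \qquad M_x=\begin{cases}0,&x=0,\\ b_x-\frac{3b_x^2}{10},&0<x\le\frac3{10},\\ 1-\frac1{2b_x^2}+\frac1{5b_x^3},&\frac3{10}<x<1,\\ 1,&x=1.\end{cases} \] For $b>0$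 and $v\in[0,1]$ let \[ s_v=\begin{cases}\sqrt{2v/b},&(b\ge1\text{ and }v\le\frac1{2b})\text{ or }(b\le1\text{ and }v\le\frac b2),\\ v+\frac1{2b},&\frac1{2b}<v\le1-\frac1{2b},\\ \frac vb+\frac12,&\frac b2<v\le1-\frac b2,\\ 1+\frac1b-\sqrt{2(1-v)/b},&(b\ge1\text{ and }1-\frac1{2b}<v)\text{ or }(b\le1\text{ and }1-\frac b2<v),\end{cases} \] and, for $u,v\in[0,1]$, \[ C_b(u,v)=\int_0^u\min\{\max\{b(s_v-t),0\},1\}\,dt , \] and for $b<0$ let $C_b(u,v)=v-C_{-b}(1-u,v)$. **Theorem.** The set of attainable pairs is \[ \mathcal R:=\{(\xi(C),\rho(C)):C\in\mathcal C\}=\{(x,y)\in\mathbb R^2: x\in[0,1],\ |y|\le M_x\}. \] The set $\mathcal R$ is convex. Every $C_b$ with $b\in\mathbb R\setminus\{0\}$ is a copula, and the family describes the boundary of $\mathcal R$: one has $\partial\mathcal R\cap\{(x,y):0<x<1\}=\{(\xi(C_b),\rho(C_b)):b\in\mathbb R\setminus\{0\}\}$. More precisely, for every $x\in(0,1)$,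 the function $C_{b_x}$ is a copula with $\xi=x$ and $\rho=M_x$ and is the only such copula, and $C_{-b_x}$ is a copula with $\xi=x$ and $\rho=-M_x$ and is the only such copula. -/

import Mathlib

open Set MeasureTheory

noncomputable section

/-- A bivariate copula: a function on the unit square with values in `[0,1]` that is grounded,
has uniform marginals and is two-increasing. It is represented by a function on `ℝ × ℝ`
of which only the values on `[0,1] × [0,1]` matter. -/
structure IsCopula (C : ℝ → ℝ → ℝ) : Prop where
  mapsTo : ∀ u ∈ Icc (0 : ℝ) 1, ∀ v ∈ Icc (0 : ℝ) 1, C u v ∈ Icc (0 : ℝ) 1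
  grounded_left : ∀ v ∈ Icc (0 : ℝ) 1, C 0 v = 0
  grounded_right : ∀ u ∈ Icc (0 : ℝ) 1, C u 0 = 0
  marginal_left : ∀ v ∈ Icc (0 : ℝ) 1, C 1 v = v
  marginal_right : ∀ u ∈ Icc (0 : ℝ) 1, C u 1 = u
  two_increasing : ∀ u ∈ Icc (0 : ℝ) 1, ∀ u' ∈ Icc (0 : ℝ) 1,
    ∀ v ∈ Icc (0 : ℝ) 1, ∀ v' ∈ Icc (0 : ℝ) 1, u ≤ u' → v ≤ v' →
      0 ≤ C u v + C u' v' - C u v' - C u' v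

/-- Spearman's rho of a copula, `12 ∫ C dλ² - 3` over the unit square. -/
def spearmanRho (C : ℝ → ℝ → ℝ) : ℝ :=
  12 * (∫ p : ℝ × ℝ in Icc (0 : ℝ) 1 ×ˢ Icc (0 : ℝ) 1, C p.1 p.2) - 3

/-- Chatterjee's xi of a copula, `6 ∫₀¹ ∫₀¹ (∂₁ C(t,v))² dt dv - 2`. For a copula the partial
derivative exists for almost every `t` in `[0,1]` and is bounded there by `0` and `1`. -/
def chatterjeeXi (C : ℝ → ℝ → ℝ) : ℝ :=
  6 * (∫ v in (0 : ℝ)..1, ∫ t in (0 : ℝ)..1, (deriv (fun s => C s v) t) ^ 2) - 2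

/-- The set of all attainable pairs `(ξ(C), ρ(C))`. -/
def xiRhoRegion : Set (ℝ × ℝ) :=
  {p | ∃ C : ℝ → ℝ → ℝ, IsCopula C ∧ p = (chatterjeeXi C, spearmanRho C)}

/-- The parameter `b_x`, for `0 < x < 1`. -/
def bParam (x : ℝ) : ℝ :=
  if x ≤ 3 / 10 then
    √(6 * x) / (2 * Real.cos (1 / 3 * Real.arccos (-(3 * √(6 * x) / 5))))
  else
    (5 + √(5 * (6 * x - 1))) / (10 * (1 - x))

/-- The bound `M_x`, for `0 ≤ x ≤ 1`. -/
def maxRho (x : ℝ) : ℝ :=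
  if x = 0 then 0
  else if x ≤ 3 / 10 then bParam x - 3 * bParam x ^ 2 / 10
  else if x < 1 then 1 - 1 / (2 * bParam x ^ 2) + 1 / (5 * bParam x ^ 3)
  else 1

/-- The horizontal band-maximum `s_v`, for `b > 0` and `0 ≤ v ≤ 1`. The last branch is the case
`1 ≤ b`, `1 - 1 / (2 b) < v` or `b ≤ 1`, `1 - b / 2 < v`. -/
def bandMax (b v : ℝ) : ℝ :=
  if (1 ≤ b ∧ v ≤ 1 / (2 * b)) ∨ (b ≤ 1 ∧ v ≤ b / 2) then √(2 * v / b)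
  else if 1 / (2 * b) < v ∧ v ≤ 1 - 1 / (2 * b) then v + 1 / (2 * b)
  else if b / 2 < v ∧ v ≤ 1 - b / 2 then v / b + 1 / 2
  else 1 + 1 / b - √(2 * (1 - v) / b)

/-- The function `C_b` for `b > 0`: the integral over `[0,u]` of the clamped linear function
`h_v(t) = clamp (b (s_v - t), 0, 1)`. With `a_v = s_v - 1 / b` and `a = max a_v 0`, this is
`u` for `u ≤ a_v`, is `a + b (s_v (u - a) + (a² - u²) / 2)` for `a < u ≤ s_v`, and is `v`
for `s_v < u ≤ 1`. -/
def bandCopulaPos (b u v : ℝ) : ℝ :=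
  ∫ t in (0 : ℝ)..u, min (max (b * (bandMax b v - t)) 0) 1

/-- The family `C_b`, for `b ≠ 0`; for `b < 0` it is `v - C_{-b}(1 - u, v)`. -/
def bandCopula (b u v : ℝ) : ℝ :=
  if 0 < b then bandCopulaPos b u v else v - bandCopulaPos (-b) (1 - u) v

end

/-! For fixed `v`, put `h_v(t) = ∂₁C(t,v)`, a function with values in `[0,1]` and integral `v`.
Integration by parts turns `ρ` into a linear functional of `h`, `12∬(1-t)h - 3`, while `ξ = 6∬h² -
2` is quadratic. Maximizing `ρ - ξ/b` therefore decouples over `v`: the constraint `∫h_v = v`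
contributes a Lagrange multiplier, which shifts the target `b(1-t)` to `b(s_v-t)`, and the optimum
is the pointwise projection of this ramp onto `[0,1]`, the density of `C_b`. The projection
inequality `sq_sub_clampedRamp_le` keeps a quadratic remainder, and its integral is
`IsCopula.support`: `b(ρ(C)-ρ(C_b)) + 6‖∂₁C-∂₁C_b‖² ≤ ξ(C)-ξ(C_b)`.

Without the remainder this is a line of slope `1/b` supporting the region at the point of `C_b`;
with the remainder it shows that only `C_b` attains that point. The moments of the truncated ramp
give `ξ(C_b)` and `ρ(C_b)` in closed form, and `bParam` inverts `b ↦ ξ(C_b)` by solving a cubic or a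
quadratic, so the supporting lines yield `|ρ| ≤ maxRho ξ` for `0 < ξ < 1`. The endpoints follow by
taking `b` small or large.

Reversing the first coordinate keeps `ξ` and negates `ρ`, which gives the lower boundary. Reversing
it only on `[θ,1]` also keeps `ξ`, and `ρ` moves continuously from `-ρ(C)` to `ρ(C)` as `θ` runs
from 0 to 1, so each vertical segment is filled (`IsCopula.exists_of_abs_le`). Convexity and the
description of the frontier come from the same supporting lines. -/

noncomputable section

/-! ### Monotonicity and Lipschitz bounds for copulas -/

/-- The retraction of the real line onto the unit interval. -/
def unitClamp (t : ℝ) : ℝ := max 0 (min t 1)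

lemma unitClamp_mem (t : ℝ) : unitClamp t ∈ Icc (0 : ℝ) 1 :=
  ⟨le_max_left _ _, max_le zero_le_one (min_le_right _ _)⟩

lemma unitClamp_of_mem {t : ℝ} (ht : t ∈ Icc (0 : ℝ) 1) : unitClamp t = t := by
  rw [unitClamp, min_eq_left ht.2, max_eq_right ht.1]

lemma unitClamp_mono : Monotone unitClamp := fun _ _ h => max_le_max le_rfl (min_le_min_right _ h)

lemma abs_unitClamp_sub_le (s t : ℝ) : |unitClamp s - unitClamp t| ≤ |s - t| := by
  unfold unitClamp; grind

namespace IsCopula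

variable {C : ℝ → ℝ → ℝ}

lemma mono_left (hC : IsCopula C) {u u' v : ℝ} (hu : u ∈ Icc (0 : ℝ) 1) (hu' : u' ∈ Icc (0 : ℝ) 1)
    (hv : v ∈ Icc (0 : ℝ) 1) (h : u ≤ u') : C u v ≤ C u' v := by
  have := hC.two_increasing u hu u' hu' 0 (by simp) v hv h hv.1
  rw [hC.grounded_right u hu, hC.grounded_right u' hu'] at this
  linarith

lemma mono_right (hC : IsCopula C) {u v v' : ℝ} (hu : u ∈ Icc (0 : ℝ) 1) (hv : v ∈ Icc (0 : ℝ) 1)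
    (hv' : v' ∈ Icc (0 : ℝ) 1) (h : v ≤ v') : C u v ≤ C u v' := by
  have := hC.two_increasing 0 (by simp) u hu v hv v' hv' hu.1 h
  rw [hC.grounded_left v hv, hC.grounded_left v' hv'] at this
  linarith

lemma sub_left_le (hC : IsCopula C) {u u' v : ℝ} (hu : u ∈ Icc (0 : ℝ) 1)
    (hu' : u' ∈ Icc (0 : ℝ) 1) (hv : v ∈ Icc (0 : ℝ) 1) (h : u ≤ u') :
    C u' v - C u v ≤ u' - u := by
  have := hC.two_increasing u hu u' hu' v hv 1 (by simp) h hv.2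
  rw [hC.marginal_right u hu, hC.marginal_right u' hu'] at this
  linarith

lemma sub_right_le (hC : IsCopula C) {u v v' : ℝ} (hu : u ∈ Icc (0 : ℝ) 1)
    (hv : v ∈ Icc (0 : ℝ) 1) (hv' : v' ∈ Icc (0 : ℝ) 1) (h : v ≤ v') :
    C u v' - C u v ≤ v' - v := by
  have := hC.two_increasing u hu 1 (by simp) v hv v' hv' hu.2 h
  rw [hC.marginal_left v hv, hC.marginal_left v' hv'] at this
  linarith

lemma abs_sub_left_le (hC : IsCopula C) {u u' v : ℝ} (hu : u ∈ Icc (0 : ℝ) 1)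
    (hu' : u' ∈ Icc (0 : ℝ) 1) (hv : v ∈ Icc (0 : ℝ) 1) : |C u v - C u' v| ≤ |u - u'| := by
  rcases le_total u u' with h | h
  · rw [abs_sub_comm, abs_sub_comm u, abs_of_nonneg (by linarith [hC.mono_left hu hu' hv h]),
      abs_of_nonneg (by linarith)]
    exact hC.sub_left_le hu hu' hv h
  · rw [abs_of_nonneg (by linarith [hC.mono_left hu' hu hv h]), abs_of_nonneg (by linarith)]
    exact hC.sub_left_le hu' hu hv h

lemma abs_sub_right_le (hC : IsCopula C) {u v v' : ℝ} (hu : u ∈ Icc (0 : ℝ) 1)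
    (hv : v ∈ Icc (0 : ℝ) 1) (hv' : v' ∈ Icc (0 : ℝ) 1) : |C u v - C u v'| ≤ |v - v'| := by
  rcases le_total v v' with h | h
  · rw [abs_sub_comm, abs_sub_comm v, abs_of_nonneg (by linarith [hC.mono_right hu hv hv' h]),
      abs_of_nonneg (by linarith)]
    exact hC.sub_right_le hu hv hv' h
  · rw [abs_of_nonneg (by linarith [hC.mono_right hu hv' hv h]), abs_of_nonneg (by linarith)]
    exact hC.sub_right_le hu hv' hv h

end IsCopula

/-! ### The density `∂₁C` and the two functionals in terms of it -/

/-- The extension of a function on the unit square that is constant along the retraction. -/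
def squareExtension (C : ℝ → ℝ → ℝ) (u v : ℝ) : ℝ := C (unitClamp u) (unitClamp v)

lemma squareExtension_of_mem (C : ℝ → ℝ → ℝ) {u v : ℝ} (hu : u ∈ Icc (0 : ℝ) 1)
    (hv : v ∈ Icc (0 : ℝ) 1) : squareExtension C u v = C u v := by
  rw [squareExtension, unitClamp_of_mem hu, unitClamp_of_mem hv]

/-- The partial derivative `∂₁ C(t, v)` as a function of `v` and `t`. -/
def copulaDensity (C : ℝ → ℝ → ℝ) (v t : ℝ) : ℝ := deriv (fun s => squareExtension C s v) t

/-- Values of `C` off the square are arbitrary, so the derivatives can differ at the endpoints of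
the interval; these form a null set and do not affect the integrals. -/
lemma copulaDensity_eq_deriv (C : ℝ → ℝ → ℝ) {v t : ℝ} (hv : v ∈ Icc (0 : ℝ) 1)
    (ht : t ∈ Ioo (0 : ℝ) 1) : copulaDensity C v t = deriv (fun s => C s v) t := by
  refine Filter.EventuallyEq.deriv_eq ?_
  filter_upwards [isOpen_Ioo.mem_nhds ht] with s hs
  exact squareExtension_of_mem C (Ioo_subset_Icc_self hs) hv

namespace IsCopula

variable {C : ℝ → ℝ → ℝ}

lemma continuous_squareExtension (hC : IsCopula C) :
    Continuous (Function.uncurry (squareExtension C)) := by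
  have : LipschitzWith 2 (Function.uncurry (squareExtension C)) := by
    refine LipschitzWith.of_dist_le_mul fun p q => ?_
    have h1 := hC.abs_sub_left_le (unitClamp_mem p.1) (unitClamp_mem q.1) (unitClamp_mem p.2)
    have h2 := hC.abs_sub_right_le (unitClamp_mem q.1) (unitClamp_mem p.2) (unitClamp_mem q.2)
    have h3 := abs_unitClamp_sub_le p.1 q.1
    have h4 := abs_unitClamp_sub_le p.2 q.2
    have h5 : |p.1 - q.1| ≤ dist p q := le_max_left _ _
    have h6 : |p.2 - q.2| ≤ dist p q := le_max_right _ _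
    have h7 := abs_sub_le (squareExtension C p.1 p.2) (squareExtension C q.1 p.2)
      (squareExtension C q.1 q.2)
    simp only [Function.uncurry, Real.dist_eq (squareExtension C p.1 p.2), NNReal.coe_ofNat]
    unfold squareExtension at *
    linarith
  exact this.continuous

lemma continuousOn (hC : IsCopula C) :
    ContinuousOn (Function.uncurry C) (Icc (0 : ℝ) 1 ×ˢ Icc (0 : ℝ) 1) :=
  hC.continuous_squareExtension.continuousOn.congr fun _ hp =>
    (squareExtension_of_mem C hp.1 hp.2).symm

lemma lipschitzWith_squareExtension (hC : IsCopula C) (v : ℝ) :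
    LipschitzWith 1 fun u => squareExtension C u v := by
  refine LipschitzWith.of_dist_le_mul fun u u' => ?_
  rw [NNReal.coe_one, one_mul]
  exact (hC.abs_sub_left_le (unitClamp_mem u) (unitClamp_mem u') (unitClamp_mem v)).trans
    (abs_unitClamp_sub_le u u')

lemma monotone_squareExtension (hC : IsCopula C) (v : ℝ) :
    Monotone fun u => squareExtension C u v := fun u u' h =>
  hC.mono_left (unitClamp_mem u) (unitClamp_mem u') (unitClamp_mem v) (unitClamp_mono h)

lemma measurable_copulaDensity (hC : IsCopula C) :
    Measurable (Function.uncurry (copulaDensity C)) :=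
  measurable_deriv_with_param (f := fun v s => squareExtension C s v)
    (hC.continuous_squareExtension.comp continuous_swap)

lemma copulaDensity_nonneg (hC : IsCopula C) (v t : ℝ) : 0 ≤ copulaDensity C v t :=
  (hC.monotone_squareExtension v).deriv_nonneg

lemma copulaDensity_le_one (hC : IsCopula C) (v t : ℝ) : copulaDensity C v t ≤ 1 :=
  (le_abs_self _).trans (norm_deriv_le_of_lipschitz (hC.lipschitzWith_squareExtension v))

lemma absolutelyContinuous (hC : IsCopula C) (v a b : ℝ) :
    AbsolutelyContinuousOnInterval (fun u => squareExtension C u v) a b :=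
  (hC.lipschitzWith_squareExtension v).lipschitzOnWith.absolutelyContinuousOnInterval

lemma integral_copulaDensity (hC : IsCopula C) {u v : ℝ} (hu : u ∈ Icc (0 : ℝ) 1)
    (hv : v ∈ Icc (0 : ℝ) 1) : ∫ t in (0 : ℝ)..u, copulaDensity C v t = C u v := by
  have := (hC.absolutelyContinuous v 0 u).integral_deriv_eq_sub
  rw [squareExtension_of_mem C hu hv, squareExtension_of_mem C (by simp) hv,
    hC.grounded_left v hv, sub_zero] at this
  exact this

/-- Integration by parts for absolutely continuous functions: the factor `1 - t` kills the boundary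
term at 1 and groundedness the one at 0. This makes `ρ` linear in the density. -/
lemma integral_one_sub_mul_copulaDensity (hC : IsCopula C) {v : ℝ} (hv : v ∈ Icc (0 : ℝ) 1) :
    ∫ t in (0 : ℝ)..1, (1 - t) * copulaDensity C v t = ∫ u in (0 : ℝ)..1, C u v := by
  have hid : AbsolutelyContinuousOnInterval (fun t : ℝ => 1 - t) 0 1 :=
    ContDiffOn.absolutelyContinuousOnInterval (by fun_prop)
  have hI := AbsolutelyContinuousOnInterval.integral_mul_deriv_eq_deriv_mul hid
    (hC.absolutelyContinuous v 0 1)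
  change ∫ t in (0 : ℝ)..1, (1 - t) * copulaDensity C v t = _ at hI
  have hd : deriv (fun t : ℝ => 1 - t) = fun _ => -1 :=
    funext fun t => ((hasDerivAt_id t).const_sub 1).deriv
  rw [hI, squareExtension_of_mem C (by simp) hv, squareExtension_of_mem C (by simp) hv,
    hC.grounded_left v hv, hd]
  simp only [sub_self, zero_mul, mul_zero, neg_mul, one_mul, intervalIntegral.integral_neg,
    zero_sub, neg_neg]
  refine intervalIntegral.integral_congr fun u hu => ?_
  rw [uIcc_of_le zero_le_one] at hu
  exact squareExtension_of_mem C hu hv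

lemma chatterjeeXi_eq (C : ℝ → ℝ → ℝ) :
    chatterjeeXi C = 6 * (∫ v in (0 : ℝ)..1, ∫ t in (0 : ℝ)..1, copulaDensity C v t ^ 2) - 2 := by
  unfold chatterjeeXi
  congr 2
  refine intervalIntegral.integral_congr fun v hv => ?_
  rw [uIcc_of_le zero_le_one] at hv
  refine intervalIntegral.integral_congr_Ioo_of_le zero_le_one fun t ht => ?_
  simp only [copulaDensity_eq_deriv C hv ht]

lemma setIntegral_eq (hC : IsCopula C) :
    ∫ p : ℝ × ℝ in Icc (0 : ℝ) 1 ×ˢ Icc (0 : ℝ) 1, C p.1 p.2 =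
      ∫ v in (0 : ℝ)..1, ∫ u in (0 : ℝ)..1, C u v := by
  rw [Measure.volume_eq_prod, ← setIntegral_prod_swap]
  simp only [Prod.fst_swap, Prod.snd_swap]
  have hc : ContinuousOn (fun z : ℝ × ℝ => C z.2 z.1) (Icc (0 : ℝ) 1 ×ˢ Icc (0 : ℝ) 1) :=
    hC.continuousOn.comp continuous_swap.continuousOn fun z hz => ⟨hz.2, hz.1⟩
  rw [setIntegral_prod _
    (hc.integrableOn_compact (isCompact_Icc.prod isCompact_Icc))]
  simp only [intervalIntegral.integral_of_le zero_le_one, integral_Icc_eq_integral_Ioc]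

lemma spearmanRho_eq (hC : IsCopula C) :
    spearmanRho C =
      12 * (∫ v in (0 : ℝ)..1, ∫ t in (0 : ℝ)..1, (1 - t) * copulaDensity C v t) - 3 := by
  rw [spearmanRho, hC.setIntegral_eq]
  congr 2
  refine intervalIntegral.integral_congr fun v hv => ?_
  rw [uIcc_of_le zero_le_one] at hv
  exact (hC.integral_one_sub_mul_copulaDensity hv).symm

end IsCopula

/-! ### Integrability of sections -/

/-- A jointly measurable function that is bounded on the unit square has integrable sections. -/
lemma intervalIntegrable_section {f : ℝ → ℝ → ℝ} (hf : Measurable (Function.uncurry f)) {M : ℝ}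
    (hM : ∀ v t, t ∈ Icc (0 : ℝ) 1 → |f v t| ≤ M) (v : ℝ) {a b : ℝ} (ha : a ∈ Icc (0 : ℝ) 1)
    (hb : b ∈ Icc (0 : ℝ) 1) : IntervalIntegrable (f v) volume a b := by
  have h : IntegrableOn (f v) (Icc 0 1) := by
    refine Measure.integrableOn_of_bounded (M := M) (by simp)
      (hf.comp measurable_prodMk_left).aestronglyMeasurable ?_
    exact (ae_restrict_iff' measurableSet_Icc).2 (.of_forall fun t ht => hM v t ht)
  exact (h.mono_set (ordConnected_Icc.uIcc_subset ha hb)).intervalIntegrable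

/-- A jointly measurable function that is bounded on the unit square has an integrable section
integral. -/
lemma intervalIntegrable_integral_section {f : ℝ → ℝ → ℝ} (hf : Measurable (Function.uncurry f))
    {M : ℝ} (hM : ∀ v t, t ∈ Icc (0 : ℝ) 1 → |f v t| ≤ M) {a b : ℝ} :
    IntervalIntegrable (fun v => ∫ t in (0 : ℝ)..1, f v t) volume a b := by
  have hm : StronglyMeasurable fun v => ∫ t in (0 : ℝ)..1, f v t := by
    simp only [intervalIntegral.integral_of_le zero_le_one]
    exact hf.stronglyMeasurable.integral_prod_right
  rw [intervalIntegrable_iff]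
  refine Measure.integrableOn_of_bounded (M := M) (by simp) hm.aestronglyMeasurable ?_
  refine .of_forall fun v => ?_
  have := intervalIntegral.norm_integral_le_of_norm_le_const (a := 0) (b := 1) (f := f v) (C := M)
    fun t ht => hM v t (by rw [uIoc_of_le zero_le_one] at ht; exact Ioc_subset_Icc_self ht)
  simpa using this

/-! ### The truncated ramp and its moments -/

/-- The linear function `b (s - t)` truncated to the unit interval. -/
def clampedRamp (b s t : ℝ) : ℝ := min (max (b * (s - t)) 0) 1

lemma continuous_clampedRamp (b s : ℝ) : Continuous (clampedRamp b s) := by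
  unfold clampedRamp; fun_prop

lemma clampedRamp_nonneg (b s t : ℝ) : 0 ≤ clampedRamp b s t :=
  le_min (le_max_right _ _) zero_le_one

lemma clampedRamp_le_one (b s t : ℝ) : clampedRamp b s t ≤ 1 := min_le_right _ _

lemma clampedRamp_mono {b s s' : ℝ} (hb : 0 ≤ b) (h : s ≤ s') (t : ℝ) :
    clampedRamp b s t ≤ clampedRamp b s' t :=
  min_le_min_right _ (max_le_max_right _ (mul_le_mul_of_nonneg_left (by linarith) hb))

/-- Truncation to `[0,1]` commutes with `x ↦ 1 - x`. Through this symmetry the sections with `v`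
near 1 reduce to those with `v` near 0. -/
lemma clampedRamp_reflect {b : ℝ} (hb : 0 < b) (s t : ℝ) :
    clampedRamp b (1 + 1 / b - s) t = 1 - clampedRamp b s (1 - t) := by
  have : b * (1 + 1 / b - s - t) = 1 - b * (s - (1 - t)) := by field_simp; ring
  unfold clampedRamp
  rw [this]
  generalize b * (s - (1 - t)) = x
  rcases le_total x 0 with h | h
  · rw [max_eq_left (by linarith), min_eq_right (by linarith), max_eq_right h,
      min_eq_left zero_le_one, sub_zero]
  rcases le_total x 1 with h' | h'
  · rw [max_eq_left (by linarith), min_eq_left (by linarith), max_eq_left h, min_eq_left h']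
  · rw [max_eq_right (by linarith), min_eq_left zero_le_one, max_eq_left h, min_eq_right h',
      sub_self]

/-- The truncated ramp is the projection of the ramp onto `[0,1]`. -/
lemma sq_sub_clampedRamp_le (b s t : ℝ) {k : ℝ} (h0 : 0 ≤ k) (h1 : k ≤ 1) :
    clampedRamp b s t ^ 2 + 2 * (b * (s - t)) * (k - clampedRamp b s t)
      + (k - clampedRamp b s t) ^ 2 ≤ k ^ 2 := by
  -- With `p` the projection of `x` onto `[0,1]`, this is the variational inequality `(p - x)(k - p)
  -- ≥ 0`; twice the left side is exactly the gap in the claim.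
  have : 0 ≤ (clampedRamp b s t - b * (s - t)) * (k - clampedRamp b s t) := by
    unfold clampedRamp
    rcases le_total (b * (s - t)) 0 with h | h
    · rw [max_eq_right h, min_eq_left zero_le_one]
      exact mul_nonneg (by linarith) (by linarith)
    rw [max_eq_left h]
    rcases le_total (b * (s - t)) 1 with h' | h'
    · simp [min_eq_left h']
    · rw [min_eq_right h']
      exact mul_nonneg_of_nonpos_of_nonpos (by linarith) (by linarith)
  nlinarith

lemma integral_quadratic (p q r a c : ℝ) :
    ∫ t in a..c, (p + q * t + r * t ^ 2) =
      p * (c - a) + q * (c ^ 2 - a ^ 2) / 2 + r * (c ^ 3 - a ^ 3) / 3 := by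
  have h : ∀ x ∈ uIcc a c, HasDerivAt (fun t : ℝ => p * t + q / 2 * t ^ 2 + r / 3 * t ^ 3)
      (p + q * x + r * x ^ 2) x := fun x _ => by
    convert! (((hasDerivAt_id x).const_mul p).add ((hasDerivAt_pow 2 x).const_mul (q / 2))).add
      ((hasDerivAt_pow 3 x).const_mul (r / 3)) using 1
    norm_num
    ring
  rw [intervalIntegral.integral_eq_sub_of_hasDerivAt h
    (Continuous.intervalIntegrable (by fun_prop) _ _)]
  ring

section Moments

variable {b s a c : ℝ}

/-- The ramp is 1 before `a`, linear on `[a,c]` and 0 after `c`. The alternatives `a = 0` and `c =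
1` allow the corresponding flat piece to be absent, so one formula serves every shape of section. -/
lemma integral_comp_clampedRamp (hb : 0 < b) (h0a : 0 ≤ a) (hac : a ≤ c) (hc1 : c ≤ 1)
    (ha : b * (s - a) ≤ 1) (ha' : a = 0 ∨ 1 ≤ b * (s - a)) (hc : c ≤ s) (hc' : c = 1 ∨ s ≤ c)
    {φ : ℝ → ℝ → ℝ} (hφ : Continuous (Function.uncurry φ)) :
    ∫ t in (0 : ℝ)..1, φ (clampedRamp b s t) t =
      (∫ t in (0 : ℝ)..a, φ 1 t) + (∫ t in a..c, φ (b * (s - t)) t) + ∫ t in c..1, φ 0 t := by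
  have hcont : Continuous fun t => φ (clampedRamp b s t) t :=
    hφ.comp ((continuous_clampedRamp b s).prodMk continuous_id)
  have hi : ∀ x y : ℝ, IntervalIntegrable (fun t => φ (clampedRamp b s t) t) volume x y :=
    fun x y => hcont.intervalIntegrable x y
  rw [← intervalIntegral.integral_add_adjacent_intervals (hi 0 c) (hi c 1),
    ← intervalIntegral.integral_add_adjacent_intervals (hi 0 a) (hi a c)]
  congr 1
  · congr 1
    · refine intervalIntegral.integral_congr_Ioo_of_le h0a fun t ht => ?_
      have h1 : 1 ≤ b * (s - t) := by
        rcases ha' with rfl | h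
        · exact absurd (ht.1.trans ht.2) (lt_irrefl _)
        · nlinarith [ht.2]
      simp only [clampedRamp]
      rw [min_eq_right (h1.trans (le_max_left _ _))]
    · refine intervalIntegral.integral_congr_Ioo_of_le hac fun t ht => ?_
      have h0 : 0 ≤ b * (s - t) := mul_nonneg hb.le (by linarith [ht.2])
      have h1 : b * (s - t) ≤ 1 := by nlinarith [ht.1]
      simp only [clampedRamp]
      rw [max_eq_left h0, min_eq_left h1]
  · refine intervalIntegral.integral_congr_Ioo_of_le hc1 fun t ht => ?_
    have h0 : b * (s - t) ≤ 0 := by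
      rcases hc' with rfl | h
      · exact absurd (ht.1.trans ht.2) (lt_irrefl _)
      · exact mul_nonpos_of_nonneg_of_nonpos hb.le (by linarith [ht.1])
    simp only [clampedRamp]
    rw [max_eq_right h0, min_eq_left zero_le_one]

lemma integral_clampedRamp (hb : 0 < b) (h0a : 0 ≤ a) (hac : a ≤ c) (hc1 : c ≤ 1)
    (ha : b * (s - a) ≤ 1) (ha' : a = 0 ∨ 1 ≤ b * (s - a)) (hc : c ≤ s) (hc' : c = 1 ∨ s ≤ c) :
    ∫ t in (0 : ℝ)..1, clampedRamp b s t = a + b * (s * (c - a) - (c ^ 2 - a ^ 2) / 2) := by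
  rw [integral_comp_clampedRamp hb h0a hac hc1 ha ha' hc hc' (φ := fun h _ => h) (by fun_prop)]
  have : ∀ t : ℝ, b * (s - t) = b * s + (-b) * t + 0 * t ^ 2 := fun t => by ring
  simp only [this, integral_quadratic, intervalIntegral.integral_const, smul_eq_mul]
  ring

lemma integral_clampedRamp_sq (hb : 0 < b) (h0a : 0 ≤ a) (hac : a ≤ c) (hc1 : c ≤ 1)
    (ha : b * (s - a) ≤ 1) (ha' : a = 0 ∨ 1 ≤ b * (s - a)) (hc : c ≤ s) (hc' : c = 1 ∨ s ≤ c) :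
    ∫ t in (0 : ℝ)..1, clampedRamp b s t ^ 2 =
      a + b ^ 2 * ((s - a) ^ 3 - (s - c) ^ 3) / 3 := by
  rw [integral_comp_clampedRamp hb h0a hac hc1 ha ha' hc hc' (φ := fun h _ => h ^ 2)
    (by fun_prop)]
  have : ∀ t : ℝ, (b * (s - t)) ^ 2 = b ^ 2 * s ^ 2 + (-2 * b ^ 2 * s) * t + b ^ 2 * t ^ 2 :=
    fun t => by ring
  simp only [this, integral_quadratic, intervalIntegral.integral_const, smul_eq_mul]
  ring

lemma integral_one_sub_mul_clampedRamp (hb : 0 < b) (h0a : 0 ≤ a) (hac : a ≤ c) (hc1 : c ≤ 1)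
    (ha : b * (s - a) ≤ 1) (ha' : a = 0 ∨ 1 ≤ b * (s - a)) (hc : c ≤ s) (hc' : c = 1 ∨ s ≤ c) :
    ∫ t in (0 : ℝ)..1, (1 - t) * clampedRamp b s t =
      a - a ^ 2 / 2 +
        b * (s * (c - a) - (1 + s) * (c ^ 2 - a ^ 2) / 2 + (c ^ 3 - a ^ 3) / 3) := by
  rw [integral_comp_clampedRamp hb h0a hac hc1 ha ha' hc hc' (φ := fun h t => (1 - t) * h)
    (by fun_prop)]
  have h1 : ∀ t : ℝ, (1 - t) * 1 = 1 + (-1) * t + 0 * t ^ 2 := fun t => by ring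
  have h2 : ∀ t : ℝ, (1 - t) * (b * (s - t)) = b * s + (-(b * (1 + s))) * t + b * t ^ 2 :=
    fun t => by ring
  simp only [h1, h2, integral_quadratic, mul_zero, intervalIntegral.integral_zero]
  ring

end Moments

/-! ### Sections of the band copula -/

/-- The density `∂₁ C_b(t, v)` of the band copula. -/
def bandDensity (b v t : ℝ) : ℝ := clampedRamp b (bandMax b v) t

lemma bandCopulaPos_eq (b u v : ℝ) :
    bandCopulaPos b u v = ∫ t in (0 : ℝ)..u, bandDensity b v t := rfl

/-- The first breakpoint of `v ↦ bandMax b v`. -/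
def bandSplit (b : ℝ) : ℝ := min (1 / (2 * b)) (b / 2)

section Band

variable {b v : ℝ}

lemma bandSplit_of_one_le (hb : 1 ≤ b) : bandSplit b = 1 / (2 * b) :=
  min_eq_left (by rw [div_le_div_iff₀ (by linarith) two_pos]; nlinarith)

lemma bandSplit_of_le_one (h0 : 0 < b) (hb : b ≤ 1) : bandSplit b = b / 2 :=
  min_eq_right (by rw [div_le_div_iff₀ two_pos (by linarith)]; nlinarith)

lemma bandSplit_pos (hb : 0 < b) : 0 < bandSplit b := lt_min (by positivity) (by positivity)

lemma bandSplit_le_half (hb : 0 < b) : bandSplit b ≤ 1 / 2 := by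
  rcases le_total 1 b with h | h
  · rw [bandSplit_of_one_le h, div_le_div_iff₀ (by linarith) two_pos]; linarith
  · rw [bandSplit_of_le_one hb h]; linarith

lemma bandMax_low (hv : v ≤ bandSplit b) : bandMax b v = √(2 * v / b) := by
  rw [bandMax, if_pos]
  rcases le_total 1 b with h | h
  · exact .inl ⟨h, hv.trans (min_le_left _ _)⟩
  · exact .inr ⟨h, hv.trans (min_le_right _ _)⟩

lemma bandMax_middle_of_one_le (hb : 1 ≤ b) (h1 : 1 / (2 * b) < v) (h2 : v ≤ 1 - 1 / (2 * b)) :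
    bandMax b v = v + 1 / (2 * b) := by
  rw [bandMax, if_neg, if_pos ⟨h1, h2⟩]
  rintro (⟨-, h⟩ | ⟨h, h'⟩)
  · linarith
  -- The two regimes of `bandMax` overlap only at `b = 1`, where their thresholds coincide.
  · obtain rfl : b = 1 := le_antisymm h hb
    norm_num at *; linarith

lemma half_le_one_div_two_mul (h0 : 0 < b) (hb : b ≤ 1) : 1 / 2 ≤ 1 / (2 * b) := by
  rw [div_le_div_iff₀ two_pos (by linarith)]; linarith

lemma bandMax_middle_of_le_one (h0 : 0 < b) (hb : b ≤ 1) (h1 : b / 2 < v) (h2 : v ≤ 1 - b / 2) :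
    bandMax b v = v / b + 1 / 2 := by
  have := half_le_one_div_two_mul h0 hb
  rw [bandMax, if_neg, if_neg, if_pos ⟨h1, h2⟩]
  · rintro ⟨h, h'⟩; linarith
  · rintro (⟨h, h'⟩ | ⟨-, h⟩)
    · obtain rfl : b = 1 := le_antisymm hb h
      norm_num at *; linarith
    · linarith

lemma bandMax_high (hb : 0 < b) (hv : 1 - bandSplit b < v) :
    bandMax b v = 1 + 1 / b - √(2 * (1 - v) / b) := by
  have hs := bandSplit_le_half hb
  rcases le_total 1 b with h | h
  · rw [bandSplit_of_one_le h] at hv hs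
    rw [bandMax, if_neg, if_neg, if_neg]
    · rintro ⟨h1, h2⟩; linarith
    · rintro ⟨h1, h2⟩; linarith
    · rintro (⟨h1, h2⟩ | ⟨h1, h2⟩) <;> linarith
  · rw [bandSplit_of_le_one hb h] at hv hs
    have := half_le_one_div_two_mul hb h
    rw [bandMax, if_neg, if_neg, if_neg]
    · rintro ⟨h1, h2⟩; linarith
    · rintro ⟨h1, h2⟩; linarith
    · rintro (⟨h1, h2⟩ | ⟨h1, h2⟩)
      · obtain rfl : b = 1 := le_antisymm h h1
        norm_num at *; linarith
      · linarith

lemma bandMax_reflect (hb : 0 < b) (hv : v < bandSplit b) :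
    bandMax b (1 - v) = 1 + 1 / b - bandMax b v := by
  rw [bandMax_high hb (by linarith), bandMax_low hv.le, sub_sub_cancel]

lemma bandDensity_reflect (hb : 0 < b) (hv : v < bandSplit b) (t : ℝ) :
    bandDensity b (1 - v) t = 1 - bandDensity b v (1 - t) := by
  rw [bandDensity, bandMax_reflect hb hv, clampedRamp_reflect hb, bandDensity]

lemma continuous_bandDensity (b v : ℝ) : Continuous (bandDensity b v) :=
  continuous_clampedRamp b _

/-- The two terms of the minimum in `bandSplit` say that the ramp reaches 0 inside `[0,1]` (`v ≤
b/2`) and starts at height at most 1 (`v ≤ 1/(2b)`). The section is then a triangle of area `b s²/2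
= v`. -/
lemma bandMax_low_bounds (hb : 0 < b) (h0 : 0 ≤ v) (hv : v ≤ bandSplit b) :
    0 ≤ bandMax b v ∧ bandMax b v ^ 2 = 2 * v / b ∧ bandMax b v ≤ 1 ∧ b * bandMax b v ≤ 1 := by
  rw [bandMax_low hv]
  have hsq : √(2 * v / b) ^ 2 = 2 * v / b := Real.sq_sqrt (by positivity)
  refine ⟨Real.sqrt_nonneg _, hsq, ?_, ?_⟩
  · refine Real.sqrt_le_one.2 ((div_le_one hb).2 ?_)
    have := hv.trans (min_le_right _ _)
    linarith
  · have := hv.trans (min_le_left _ _)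
    rw [le_div_iff₀ (by linarith)] at this
    -- It suffices to bound the square, which is `(b s)² = 2 b v`.
    refine abs_le_one_iff_mul_self_le_one.2 ?_ |> (le_abs_self _).trans
    have e : b * √(2 * v / b) * (b * √(2 * v / b)) = b ^ 2 * √(2 * v / b) ^ 2 := by ring
    rw [e, hsq]
    field_simp
    linarith

lemma moments_bandDensity_low (hb : 0 < b) (h0 : 0 ≤ v) (hv : v ≤ bandSplit b) :
    (∫ t in (0 : ℝ)..1, bandDensity b v t) = v ∧
    (∫ t in (0 : ℝ)..1, bandDensity b v t ^ 2) = b ^ 2 / 3 * √(2 * v / b) ^ 3 ∧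
    (∫ t in (0 : ℝ)..1, (1 - t) * bandDensity b v t) = v - b / 6 * √(2 * v / b) ^ 3 := by
  obtain ⟨hs0, hsq, hs1, hbs⟩ := bandMax_low_bounds hb h0 hv
  have hA : b * (bandMax b v - 0) ≤ 1 := by simpa using hbs
  have hv' : v = b * bandMax b v ^ 2 / 2 := by rw [hsq]; field_simp
  rw [← bandMax_low hv]
  unfold bandDensity
  rw [integral_clampedRamp hb le_rfl hs0 hs1 hA (.inl rfl) le_rfl (.inr le_rfl),
    integral_clampedRamp_sq hb le_rfl hs0 hs1 hA (.inl rfl) le_rfl (.inr le_rfl),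
    integral_one_sub_mul_clampedRamp hb le_rfl hs0 hs1 hA (.inl rfl) le_rfl (.inr le_rfl)]
  generalize bandMax b v = s at *
  refine ⟨?_, ?_, ?_⟩
  · rw [hv']; ring
  · ring
  · rw [hv']; ring

/-- A steep ramp fits entirely: it descends from 1 at `v - 1/(2b)` to 0 at `v + 1/(2b)`. -/
lemma moments_bandDensity_middle_of_one_le (hb : 1 ≤ b) (h1 : 1 / (2 * b) < v)
    (h2 : v ≤ 1 - 1 / (2 * b)) :
    (∫ t in (0 : ℝ)..1, bandDensity b v t) = v ∧
    (∫ t in (0 : ℝ)..1, bandDensity b v t ^ 2) = v - 1 / (6 * b) ∧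
    (∫ t in (0 : ℝ)..1, (1 - t) * bandDensity b v t) = v - v ^ 2 / 2 - 1 / (24 * b ^ 2) := by
  have hb0 : 0 < b := by linarith
  have hp : 0 < 1 / (2 * b) := by positivity
  have hw : b * (1 / (2 * b)) = 1 / 2 := by field_simp
  have hB : b * (bandMax b v - (v - 1 / (2 * b))) = 1 := by
    rw [bandMax_middle_of_one_le hb h1 h2]; linarith
  unfold bandDensity
  rw [bandMax_middle_of_one_le hb h1 h2] at hB ⊢
  rw [integral_clampedRamp hb0 (by linarith : 0 ≤ v - 1 / (2 * b))
      (by linarith : _ ≤ v + 1 / (2 * b)) (by linarith) hB.le (.inr hB.ge) le_rfl (.inr le_rfl),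
    integral_clampedRamp_sq hb0 (by linarith : 0 ≤ v - 1 / (2 * b))
      (by linarith : _ ≤ v + 1 / (2 * b)) (by linarith) hB.le (.inr hB.ge) le_rfl (.inr le_rfl),
    integral_one_sub_mul_clampedRamp hb0 (by linarith : 0 ≤ v - 1 / (2 * b))
      (by linarith : _ ≤ v + 1 / (2 * b)) (by linarith) hB.le (.inr hB.ge) le_rfl (.inr le_rfl)]
  refine ⟨?_, ?_, ?_⟩ <;> field_simp <;> ring

/-- A flat ramp is never truncated: it runs from `v + b/2` at 0 to `v - b/2` at 1. -/
lemma moments_bandDensity_middle_of_le_one (h0 : 0 < b) (hb : b ≤ 1) (h1 : b / 2 < v)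
    (h2 : v ≤ 1 - b / 2) :
    (∫ t in (0 : ℝ)..1, bandDensity b v t) = v ∧
    (∫ t in (0 : ℝ)..1, bandDensity b v t ^ 2) = v ^ 2 + b ^ 2 / 12 ∧
    (∫ t in (0 : ℝ)..1, (1 - t) * bandDensity b v t) = v / 2 + b / 12 := by
  have e : b * (v / b) = v := by field_simp
  have hA : b * (v / b + 1 / 2 - 0) ≤ 1 := by linarith
  have hc : 1 ≤ v / b + 1 / 2 := by
    have : 1 / 2 ≤ v / b := by rw [le_div_iff₀ h0]; linarith
    linarith
  unfold bandDensity
  rw [bandMax_middle_of_le_one h0 hb h1 h2,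
    integral_clampedRamp h0 le_rfl zero_le_one le_rfl hA (.inl rfl) hc (.inl rfl),
    integral_clampedRamp_sq h0 le_rfl zero_le_one le_rfl hA (.inl rfl) hc (.inl rfl),
    integral_one_sub_mul_clampedRamp h0 le_rfl zero_le_one le_rfl hA (.inl rfl) hc (.inl rfl)]
  refine ⟨?_, ?_, ?_⟩ <;> field_simp <;> ring

lemma integral_bandDensity_reflect (hb : 0 < b) (hv : v < bandSplit b) :
    ∫ t in (0 : ℝ)..1, bandDensity b (1 - v) t = 1 - ∫ t in (0 : ℝ)..1, bandDensity b v t := by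
  have hi := (continuous_bandDensity b v).intervalIntegrable (μ := volume) 0 1
  simp only [bandDensity_reflect hb hv]
  rw [intervalIntegral.integral_comp_sub_left (fun t => 1 - bandDensity b v t) 1,
    sub_self, sub_zero, intervalIntegral.integral_sub intervalIntegrable_const hi]
  simp

/-- This is the constraint that the multiplier `s_v` is chosen to satisfy. -/
lemma integral_bandDensity (hb : 0 < b) (hv : v ∈ Icc (0 : ℝ) 1) :
    ∫ t in (0 : ℝ)..1, bandDensity b v t = v := by
  rcases le_or_gt v (bandSplit b) with h | h
  · exact (moments_bandDensity_low hb hv.1 h).1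
  rcases le_or_gt v (1 - bandSplit b) with h' | h'
  · rcases le_total 1 b with hb1 | hb1
    · rw [bandSplit_of_one_le hb1] at h h'
      exact (moments_bandDensity_middle_of_one_le hb1 h h').1
    · rw [bandSplit_of_le_one hb hb1] at h h'
      exact (moments_bandDensity_middle_of_le_one hb hb1 h h').1
  · have hw : 1 - v < bandSplit b := by linarith
    have := integral_bandDensity_reflect hb hw
    rw [(moments_bandDensity_low hb (by linarith [hv.2]) hw.le).1] at this
    simpa using this

lemma integral_bandDensity_sq_reflect (hb : 0 < b) (h0 : 0 ≤ v) (hv : v < bandSplit b) :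
    ∫ t in (0 : ℝ)..1, bandDensity b (1 - v) t ^ 2 =
      1 - 2 * v + ∫ t in (0 : ℝ)..1, bandDensity b v t ^ 2 := by
  have hc := continuous_bandDensity b v
  simp only [bandDensity_reflect hb hv]
  rw [intervalIntegral.integral_comp_sub_left (fun t => (1 - bandDensity b v t) ^ 2) 1,
    sub_self, sub_zero]
  have e : ∀ t, (1 - bandDensity b v t) ^ 2 =
      1 - 2 * bandDensity b v t + bandDensity b v t ^ 2 := fun t => by ring
  simp only [e]
  rw [intervalIntegral.integral_add (Continuous.intervalIntegrable (by fun_prop) _ _)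
      (Continuous.intervalIntegrable (by fun_prop) _ _),
    intervalIntegral.integral_sub (Continuous.intervalIntegrable (by fun_prop) _ _)
      (Continuous.intervalIntegrable (by fun_prop) _ _), intervalIntegral.integral_const_mul,
    (moments_bandDensity_low hb h0 hv.le).1]
  simp

lemma integral_one_sub_mul_bandDensity_reflect (hb : 0 < b) (h0 : 0 ≤ v)
    (hv : v < bandSplit b) :
    ∫ t in (0 : ℝ)..1, (1 - t) * bandDensity b (1 - v) t =
      1 / 2 - v + ∫ t in (0 : ℝ)..1, (1 - t) * bandDensity b v t := by
  have hc := continuous_bandDensity b v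
  simp only [bandDensity_reflect hb hv]
  rw [intervalIntegral.integral_comp_sub_left (fun t => t * (1 - bandDensity b v t)) 1,
    sub_self, sub_zero]
  have e : ∀ t, t * (1 - bandDensity b v t) =
      t - bandDensity b v t + (1 - t) * bandDensity b v t := fun t => by ring
  simp only [e]
  rw [intervalIntegral.integral_add (Continuous.intervalIntegrable (by fun_prop) _ _)
      (Continuous.intervalIntegrable (by fun_prop) _ _),
    intervalIntegral.integral_sub (Continuous.intervalIntegrable (by fun_prop) _ _)
      (Continuous.intervalIntegrable (by fun_prop) _ _),
    (moments_bandDensity_low hb h0 hv.le).1, integral_id]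
  norm_num

lemma bandDensity_nonneg (b v t : ℝ) : 0 ≤ bandDensity b v t := clampedRamp_nonneg _ _ _

lemma bandDensity_le_one (b v t : ℝ) : bandDensity b v t ≤ 1 := clampedRamp_le_one _ _ _

/-- No case analysis of `s_v` is needed: if `s_v` exceeded `s_{v'}` for some `v < v'`, the ramps
would be ordered the wrong way, and so would their integrals `v` and `v'`. -/
lemma bandDensity_mono (hb : 0 < b) {v' : ℝ} (hv : v ∈ Icc (0 : ℝ) 1) (hv' : v' ∈ Icc (0 : ℝ) 1)
    (h : v ≤ v') (t : ℝ) : bandDensity b v t ≤ bandDensity b v' t := by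
  rcases h.eq_or_lt with rfl | h
  · exact le_rfl
  refine clampedRamp_mono hb.le (le_of_not_gt fun hlt => h.not_ge ?_) t
  rw [← integral_bandDensity hb hv, ← integral_bandDensity hb hv']
  exact intervalIntegral.integral_mono zero_le_one
    ((continuous_bandDensity b v').intervalIntegrable _ _)
    ((continuous_bandDensity b v).intervalIntegrable _ _)
    fun t => clampedRamp_mono hb.le hlt.le t

/-- Monotonicity of the density in `v` gives the two-increasing property. At `v = 0` the value is
squeezed by `0 ≤ C ≤ v`; at `v = 1` a density bounded by 1 with total mass 1 forces `C(u,1) = u`. -/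
lemma isCopula_bandCopulaPos (hb : 0 < b) : IsCopula (bandCopulaPos b) := by
  have hi : ∀ v x y : ℝ, IntervalIntegrable (bandDensity b v) volume x y :=
    fun v x y => (continuous_bandDensity b v).intervalIntegrable x y
  have hsplit : ∀ v u u' : ℝ, bandCopulaPos b u' v - bandCopulaPos b u v =
      ∫ t in u..u', bandDensity b v t := fun v u u' => by
    rw [bandCopulaPos_eq, bandCopulaPos_eq,
      intervalIntegral.integral_interval_sub_left (hi v _ _) (hi v _ _)]
  have hnn : ∀ v u u' : ℝ, u ≤ u' → 0 ≤ ∫ t in u..u', bandDensity b v t := fun v u u' h =>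
    intervalIntegral.integral_nonneg h fun t _ => bandDensity_nonneg b v t
  have hle : ∀ v u u' : ℝ, u ≤ u' → ∫ t in u..u', bandDensity b v t ≤ u' - u := fun v u u' h => by
    simpa using intervalIntegral.integral_mono h (hi v u u') intervalIntegrable_const
      fun t => bandDensity_le_one b v t
  have hz : ∀ v, bandCopulaPos b 0 v = 0 := fun v => by simp [bandCopulaPos_eq]
  have h1 : ∀ v ∈ Icc (0 : ℝ) 1, bandCopulaPos b 1 v = v := fun v hv =>
    integral_bandDensity hb hv
  have hpos : ∀ u ∈ Icc (0 : ℝ) 1, ∀ v, 0 ≤ bandCopulaPos b u v := fun u hu v => by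
    have := hnn v 0 u hu.1
    rw [← hsplit, hz] at this; linarith
  have hlev : ∀ u ∈ Icc (0 : ℝ) 1, ∀ v ∈ Icc (0 : ℝ) 1, bandCopulaPos b u v ≤ v :=
    fun u hu v hv => by
      have := hnn v u 1 hu.2
      rw [← hsplit, h1 v hv] at this; linarith
  refine ⟨fun u hu v hv => ⟨hpos u hu v, (hlev u hu v hv).trans hv.2⟩, fun v _ => hz v,
    fun u hu => le_antisymm (hlev u hu 0 (by simp)) (hpos u hu 0), h1, fun u hu => ?_, ?_⟩
  · have h2 := hle 1 u 1 hu.2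
    have h3 := hle 1 0 u hu.1
    rw [← hsplit, h1 1 (by simp)] at h2
    rw [← hsplit, hz] at h3
    linarith
  · intro u _ u' _ v hv v' hv' huu hvv
    have := intervalIntegral.integral_mono huu (hi v u u') (hi v' u u')
      fun t => bandDensity_mono hb hv hv' hvv t
    rw [← hsplit, ← hsplit] at this
    linarith

lemma copulaDensity_bandCopulaPos (b : ℝ) {v t : ℝ} (hv : v ∈ Icc (0 : ℝ) 1)
    (ht : t ∈ Ioo (0 : ℝ) 1) : copulaDensity (bandCopulaPos b) v t = bandDensity b v t := by
  rw [copulaDensity_eq_deriv _ hv ht]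
  exact (continuous_bandDensity b v).deriv_integral _ 0 t

end Band

/-! ### Integration over the second coordinate -/

/-- The square root is not differentiable at 0, so the fundamental theorem is used in the form that
asks for a derivative only in the open interval. -/
lemma integral_sqrt_pow_three {c w : ℝ} (hc : 0 < c) (hw : 0 ≤ w) :
    ∫ v in (0 : ℝ)..w, √(c * v) ^ 3 = 2 / 5 * w * √(c * w) ^ 3 := by
  have hd : ∀ v ∈ Ioo 0 w, HasDerivAt (fun v : ℝ => 2 / 5 * v * √(c * v) ^ 3) (√(c * v) ^ 3) v := by
    intro v hv
    have hcv : 0 < c * v := mul_pos hc hv.1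
    have hs : 0 < √(c * v) := Real.sqrt_pos.2 hcv
    have hsq : √(c * v) ^ 2 = c * v := Real.sq_sqrt hcv.le
    have h1 : HasDerivAt (fun v : ℝ => √(c * v)) (c * 1 / (2 * √(c * v))) v :=
      ((hasDerivAt_id v).const_mul c).sqrt hcv.ne'
    convert! ((hasDerivAt_id v).const_mul (2 / 5)).mul (h1.pow 3) using 1
    simp only [id, Nat.cast_ofNat, Nat.add_one_sub_one, Pi.pow_apply]
    field_simp
    rw [hsq]
    ring
  rw [intervalIntegral.integral_eq_sub_of_hasDerivAt_of_le hw
    (Continuous.continuousOn (by fun_prop)) hd (Continuous.intervalIntegrable (by fun_prop) _ _)]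
  simp

/-- A common shape for both functionals and both regimes of `b`: explicit on `(0,v₀)`, quadratic in
the middle, and determined by reflection near 1. -/
lemma integral_three_pieces {F : ℝ → ℝ} {b v₀ α β γ δ p q r : ℝ} (hb : 0 < b)
    (hF : ∀ x y, IntervalIntegrable F volume x y) (h0 : 0 ≤ v₀) (h1 : v₀ ≤ 1 / 2)
    (hlow : ∀ v ∈ Ioo 0 v₀, F v = α * v + β * √(2 * v / b) ^ 3)
    (hrefl : ∀ v ∈ Ioo 0 v₀, F (1 - v) = γ + δ * v + F v)
    (hmid : ∀ v ∈ Ioo v₀ (1 - v₀), F v = p + q * v + r * v ^ 2) :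
    ∫ v in (0 : ℝ)..1, F v =
      α * v₀ ^ 2 + 4 / 5 * β * v₀ * √(2 * v₀ / b) ^ 3 + γ * v₀ + δ * v₀ ^ 2 / 2
        + p * (1 - 2 * v₀) + q * ((1 - v₀) ^ 2 - v₀ ^ 2) / 2
        + r * ((1 - v₀) ^ 3 - v₀ ^ 3) / 3 := by
  have hL : ∫ v in (0 : ℝ)..v₀, F v = α * v₀ ^ 2 / 2 + 2 / 5 * β * v₀ * √(2 * v₀ / b) ^ 3 := by
    have e : ∀ v, 2 * v / b = 2 / b * v := fun v => by ring
    rw [intervalIntegral.integral_congr_Ioo_of_le h0 hlow,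
      intervalIntegral.integral_add (Continuous.intervalIntegrable (by fun_prop) _ _)
        (Continuous.intervalIntegrable (by fun_prop) _ _),
      intervalIntegral.integral_const_mul, intervalIntegral.integral_const_mul, integral_id]
    simp only [e]
    rw [integral_sqrt_pow_three (by positivity) h0]
    ring
  have hR : ∫ v in (1 - v₀)..1, F v = γ * v₀ + δ * v₀ ^ 2 / 2 + ∫ v in (0 : ℝ)..v₀, F v := by
    have h := intervalIntegral.integral_comp_sub_left (a := 0) (b := v₀) F 1
    rw [sub_zero] at h
    rw [← h, intervalIntegral.integral_congr_Ioo_of_le h0 hrefl,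
      intervalIntegral.integral_add (Continuous.intervalIntegrable (by fun_prop) _ _) (hF _ _)]
    have := integral_quadratic γ δ 0 0 v₀
    simp only [zero_mul, add_zero] at this
    rw [this]
    ring
  have hM := intervalIntegral.integral_congr_Ioo_of_le (μ := volume) (by linarith) hmid
  rw [integral_quadratic] at hM
  rw [← intervalIntegral.integral_add_adjacent_intervals (hF 0 v₀) (hF v₀ 1),
    ← intervalIntegral.integral_add_adjacent_intervals (hF v₀ (1 - v₀)) (hF (1 - v₀) 1),
    hR, hM, hL]
  ring

/-! ### Integrability of the moments of a copula density -/

namespace IsCopula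

variable {C : ℝ → ℝ → ℝ}

lemma measurable_density_sq (hC : IsCopula C) :
    Measurable (Function.uncurry fun v t => copulaDensity C v t ^ 2) :=
  hC.measurable_copulaDensity.pow_const 2

lemma abs_density_sq_le (hC : IsCopula C) (v t : ℝ) : |copulaDensity C v t ^ 2| ≤ 1 := by
  rw [abs_of_nonneg (sq_nonneg _)]
  exact pow_le_one₀ (hC.copulaDensity_nonneg v t) (hC.copulaDensity_le_one v t)

lemma measurable_one_sub_mul_density (hC : IsCopula C) :
    Measurable (Function.uncurry fun v t => (1 - t) * copulaDensity C v t) :=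
  (measurable_const.sub measurable_snd).mul hC.measurable_copulaDensity

lemma abs_one_sub_mul_density_le (hC : IsCopula C) (v t : ℝ) (ht : t ∈ Icc (0 : ℝ) 1) :
    |(1 - t) * copulaDensity C v t| ≤ 1 := by
  have h0 := hC.copulaDensity_nonneg v t
  have h1 : 0 ≤ 1 - t := by linarith [ht.2]
  rw [abs_of_nonneg (mul_nonneg h1 h0)]
  exact mul_le_one₀ (by linarith [ht.1]) h0 (hC.copulaDensity_le_one v t)

lemma intervalIntegrable_integral_sq (hC : IsCopula C) (a b : ℝ) :
    IntervalIntegrable (fun v => ∫ t in (0 : ℝ)..1, copulaDensity C v t ^ 2) volume a b :=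
  intervalIntegrable_integral_section hC.measurable_density_sq fun v t _ =>
    hC.abs_density_sq_le v t

lemma intervalIntegrable_integral_one_sub_mul (hC : IsCopula C) (a b : ℝ) :
    IntervalIntegrable (fun v => ∫ t in (0 : ℝ)..1, (1 - t) * copulaDensity C v t) volume a b :=
  intervalIntegrable_integral_section hC.measurable_one_sub_mul_density
    hC.abs_one_sub_mul_density_le

end IsCopula

/-! ### Closed forms for `ξ` and `ρ` of the band copulas -/

section Band

variable {b : ℝ}

lemma integral_density_sq_band {v : ℝ} (hv : v ∈ Icc (0 : ℝ) 1) :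
    ∫ t in (0 : ℝ)..1, copulaDensity (bandCopulaPos b) v t ^ 2 =
      ∫ t in (0 : ℝ)..1, bandDensity b v t ^ 2 :=
  intervalIntegral.integral_congr_Ioo_of_le zero_le_one fun t ht => by
    simp only [copulaDensity_bandCopulaPos b hv ht]

lemma integral_one_sub_mul_density_band {v : ℝ} (hv : v ∈ Icc (0 : ℝ) 1) :
    ∫ t in (0 : ℝ)..1, (1 - t) * copulaDensity (bandCopulaPos b) v t =
      ∫ t in (0 : ℝ)..1, (1 - t) * bandDensity b v t :=
  intervalIntegral.integral_congr_Ioo_of_le zero_le_one fun t ht => by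
    simp only [copulaDensity_bandCopulaPos b hv ht]

/-- The second moment of the density of the band copula, given its values on the middle part. -/
lemma integral_integral_density_sq_band (hb : 0 < b) {p q r : ℝ}
    (hmid : ∀ v ∈ Ioo (bandSplit b) (1 - bandSplit b),
      ∫ t in (0 : ℝ)..1, bandDensity b v t ^ 2 = p + q * v + r * v ^ 2) :
    ∫ v in (0 : ℝ)..1, ∫ t in (0 : ℝ)..1, copulaDensity (bandCopulaPos b) v t ^ 2 =
      4 / 15 * b ^ 2 * bandSplit b * √(2 * bandSplit b / b) ^ 3 + bandSplit b - bandSplit b ^ 2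
        + p * (1 - 2 * bandSplit b) + q * ((1 - bandSplit b) ^ 2 - bandSplit b ^ 2) / 2
        + r * ((1 - bandSplit b) ^ 3 - bandSplit b ^ 3) / 3 := by
  have h0 := (bandSplit_pos hb).le
  have h1 := bandSplit_le_half hb
  -- `α` and `β` come from the triangle moment, `γ` and `δ` from `integral_bandDensity_sq_reflect`.
  rw [integral_three_pieces (α := 0) (β := b ^ 2 / 3) (γ := 1) (δ := -2) (p := p) (q := q) (r := r)
    hb ((isCopula_bandCopulaPos hb).intervalIntegrable_integral_sq) h0 h1]
  · ring
  · intro v hv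
    rw [integral_density_sq_band ⟨hv.1.le, by linarith [hv.2]⟩,
      (moments_bandDensity_low hb hv.1.le hv.2.le).2.1]
    ring
  · intro v hv
    rw [integral_density_sq_band ⟨by linarith [hv.2], by linarith [hv.1]⟩,
      integral_density_sq_band ⟨hv.1.le, by linarith [hv.2]⟩,
      integral_bandDensity_sq_reflect hb hv.1.le hv.2]
    ring
  · intro v hv
    rw [integral_density_sq_band ⟨by linarith [hv.1], by linarith [hv.2]⟩, hmid v hv]

lemma integral_integral_one_sub_mul_density_band (hb : 0 < b) {p q r : ℝ}
    (hmid : ∀ v ∈ Ioo (bandSplit b) (1 - bandSplit b),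
      ∫ t in (0 : ℝ)..1, (1 - t) * bandDensity b v t = p + q * v + r * v ^ 2) :
    ∫ v in (0 : ℝ)..1, ∫ t in (0 : ℝ)..1, (1 - t) * copulaDensity (bandCopulaPos b) v t =
      bandSplit b / 2 + bandSplit b ^ 2 / 2
        - 2 / 15 * b * bandSplit b * √(2 * bandSplit b / b) ^ 3
        + p * (1 - 2 * bandSplit b) + q * ((1 - bandSplit b) ^ 2 - bandSplit b ^ 2) / 2
        + r * ((1 - bandSplit b) ^ 3 - bandSplit b ^ 3) / 3 := by
  have h0 := (bandSplit_pos hb).le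
  have h1 := bandSplit_le_half hb
  rw [integral_three_pieces (α := 1) (β := -(b / 6)) (γ := 1 / 2) (δ := -1) (p := p) (q := q)
    (r := r) hb ((isCopula_bandCopulaPos hb).intervalIntegrable_integral_one_sub_mul) h0 h1]
  · ring
  · intro v hv
    rw [integral_one_sub_mul_density_band ⟨hv.1.le, by linarith [hv.2]⟩,
      (moments_bandDensity_low hb hv.1.le hv.2.le).2.2]
    ring
  · intro v hv
    rw [integral_one_sub_mul_density_band ⟨by linarith [hv.2], by linarith [hv.1]⟩,
      integral_one_sub_mul_density_band ⟨hv.1.le, by linarith [hv.2]⟩,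
      integral_one_sub_mul_bandDensity_reflect hb hv.1.le hv.2]
    ring
  · intro v hv
    rw [integral_one_sub_mul_density_band ⟨by linarith [hv.1], by linarith [hv.2]⟩, hmid v hv]

lemma sqrt_bandSplit_of_one_le (hb : 1 ≤ b) : √(2 * bandSplit b / b) = 1 / b := by
  have h0 : 0 < b := by linarith
  rw [bandSplit_of_one_le hb, show 2 * (1 / (2 * b)) / b = (1 / b) ^ 2 by field_simp,
    Real.sqrt_sq (by positivity)]

lemma sqrt_bandSplit_of_le_one (h0 : 0 < b) (hb : b ≤ 1) : √(2 * bandSplit b / b) = 1 := by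
  rw [bandSplit_of_le_one h0 hb, show 2 * (b / 2) / b = 1 by field_simp, Real.sqrt_one]

theorem chatterjeeXi_band_of_one_le (hb : 1 ≤ b) :
    chatterjeeXi (bandCopulaPos b) = 1 - 1 / b + 3 / (10 * b ^ 2) := by
  have h0 : 0 < b := by linarith
  rw [IsCopula.chatterjeeXi_eq, integral_integral_density_sq_band h0 (p := -(1 / (6 * b)))
    (q := 1) (r := 0), sqrt_bandSplit_of_one_le hb, bandSplit_of_one_le hb]
  · field_simp
    ring
  · intro v hv
    rw [bandSplit_of_one_le hb] at hv
    rw [(moments_bandDensity_middle_of_one_le hb hv.1 hv.2.le).2.1]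
    ring

theorem spearmanRho_band_of_one_le (hb : 1 ≤ b) :
    spearmanRho (bandCopulaPos b) = 1 - 1 / (2 * b ^ 2) + 1 / (5 * b ^ 3) := by
  have h0 : 0 < b := by linarith
  rw [(isCopula_bandCopulaPos h0).spearmanRho_eq,
    integral_integral_one_sub_mul_density_band h0 (p := -(1 / (24 * b ^ 2)))
    (q := 1) (r := -(1 / 2)), sqrt_bandSplit_of_one_le hb, bandSplit_of_one_le hb]
  · field_simp
    ring
  · intro v hv
    rw [bandSplit_of_one_le hb] at hv
    rw [(moments_bandDensity_middle_of_one_le hb hv.1 hv.2.le).2.2]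
    ring

theorem chatterjeeXi_band_of_le_one (h0 : 0 < b) (hb : b ≤ 1) :
    chatterjeeXi (bandCopulaPos b) = b ^ 2 / 2 - b ^ 3 / 5 := by
  rw [IsCopula.chatterjeeXi_eq, integral_integral_density_sq_band h0 (p := b ^ 2 / 12)
    (q := 0) (r := 1), sqrt_bandSplit_of_le_one h0 hb, bandSplit_of_le_one h0 hb]
  · field_simp
    ring
  · intro v hv
    rw [bandSplit_of_le_one h0 hb] at hv
    rw [(moments_bandDensity_middle_of_le_one h0 hb hv.1 hv.2.le).2.1]
    ring

theorem spearmanRho_band_of_le_one (h0 : 0 < b) (hb : b ≤ 1) :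
    spearmanRho (bandCopulaPos b) = b - 3 * b ^ 2 / 10 := by
  rw [(isCopula_bandCopulaPos h0).spearmanRho_eq,
    integral_integral_one_sub_mul_density_band h0 (p := b / 12)
    (q := 1 / 2) (r := 0), sqrt_bandSplit_of_le_one h0 hb, bandSplit_of_le_one h0 hb]
  · field_simp
    ring
  · intro v hv
    rw [bandSplit_of_le_one h0 hb] at hv
    rw [(moments_bandDensity_middle_of_le_one h0 hb hv.1 hv.2.le).2.2]
    ring

end Band

/-! ### The supporting inequality, uniqueness, and the range of `ξ` -/

namespace IsCopula

variable {C D : ℝ → ℝ → ℝ}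

lemma measurable_density_sub_sq (hC : IsCopula C) (hD : IsCopula D) :
    Measurable (Function.uncurry fun v t => (copulaDensity C v t - copulaDensity D v t) ^ 2) :=
  (hC.measurable_copulaDensity.sub hD.measurable_copulaDensity).pow_const 2

lemma abs_density_sub_sq_le (hC : IsCopula C) (hD : IsCopula D) (v t : ℝ) :
    |(copulaDensity C v t - copulaDensity D v t) ^ 2| ≤ 1 := by
  have := hC.copulaDensity_nonneg v t
  have := hC.copulaDensity_le_one v t
  have := hD.copulaDensity_nonneg v t
  have := hD.copulaDensity_le_one v t
  rw [abs_of_nonneg (sq_nonneg _), sq_le_one_iff_abs_le_one, abs_le]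
  constructor <;> linarith

lemma intervalIntegrable_density (hC : IsCopula C) (v : ℝ) {a b : ℝ} (ha : a ∈ Icc (0 : ℝ) 1)
    (hb : b ∈ Icc (0 : ℝ) 1) : IntervalIntegrable (copulaDensity C v) volume a b :=
  intervalIntegrable_section hC.measurable_copulaDensity (M := 1) (fun v t _ => by
    rw [abs_of_nonneg (hC.copulaDensity_nonneg v t)]; exact hC.copulaDensity_le_one v t) v ha hb

lemma intervalIntegrable_density_sq (hC : IsCopula C) (v : ℝ) {a b : ℝ} (ha : a ∈ Icc (0 : ℝ) 1)
    (hb : b ∈ Icc (0 : ℝ) 1) : IntervalIntegrable (fun t => copulaDensity C v t ^ 2) volume a b :=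
  intervalIntegrable_section hC.measurable_density_sq (fun v t _ => hC.abs_density_sq_le v t)
    v ha hb

lemma intervalIntegrable_one_sub_mul_density (hC : IsCopula C) (v : ℝ) :
    IntervalIntegrable (fun t => (1 - t) * copulaDensity C v t) volume 0 1 :=
  intervalIntegrable_section hC.measurable_one_sub_mul_density hC.abs_one_sub_mul_density_le v
    (by simp) (by simp)

lemma intervalIntegrable_density_sub_sq (hC : IsCopula C) (hD : IsCopula D) (v : ℝ) :
    IntervalIntegrable (fun t => (copulaDensity C v t - copulaDensity D v t) ^ 2) volume 0 1 :=
  intervalIntegrable_section (hC.measurable_density_sub_sq hD)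
    (fun v t _ => hC.abs_density_sub_sq_le hD v t) v (by simp) (by simp)

lemma intervalIntegrable_integral_sub_sq (hC : IsCopula C) (hD : IsCopula D) (a b : ℝ) :
    IntervalIntegrable
      (fun v => ∫ t in (0 : ℝ)..1, (copulaDensity C v t - copulaDensity D v t) ^ 2) volume a b :=
  intervalIntegrable_integral_section (hC.measurable_density_sub_sq hD)
    fun v t _ => hC.abs_density_sub_sq_le hD v t

lemma integral_density_sub_sq_nonneg (C D : ℝ → ℝ → ℝ) (v : ℝ) :
    0 ≤ ∫ t in (0 : ℝ)..1, (copulaDensity C v t - copulaDensity D v t) ^ 2 :=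
  intervalIntegral.integral_nonneg zero_le_one fun _ _ => sq_nonneg _

/-- The supporting inequality for fixed second coordinate. -/
lemma section_support (hC : IsCopula C) {b : ℝ} (hb : 0 < b) {v : ℝ} (hv : v ∈ Icc (0 : ℝ) 1) :
    (∫ t in (0 : ℝ)..1, copulaDensity (bandCopulaPos b) v t ^ 2)
      + (2 * b * ((∫ t in (0 : ℝ)..1, (1 - t) * copulaDensity C v t)
        - ∫ t in (0 : ℝ)..1, (1 - t) * copulaDensity (bandCopulaPos b) v t)
      + ∫ t in (0 : ℝ)..1, (copulaDensity C v t - copulaDensity (bandCopulaPos b) v t) ^ 2)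
      ≤ ∫ t in (0 : ℝ)..1, copulaDensity C v t ^ 2 := by
  have hB := isCopula_bandCopulaPos hb
  have i0 : (0 : ℝ) ∈ Icc (0 : ℝ) 1 := by simp
  have i1 : (1 : ℝ) ∈ Icc (0 : ℝ) 1 := by simp
  -- Splitting `2b(s_v - t) = 2b(1 - t) + c` isolates the multiplier: `c` is constant in `t` and
  -- both densities have integral `v`, so its contribution vanishes.
  set c := 2 * b * (bandMax b v - 1) with hc
  set k := copulaDensity C v with hk
  set h := copulaDensity (bandCopulaPos b) v with hh
  have I1 : IntervalIntegrable (fun t => h t ^ 2) volume 0 1 :=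
    hB.intervalIntegrable_density_sq v i0 i1
  have I2 : IntervalIntegrable (fun t => c * (k t - h t)) volume 0 1 :=
    ((hC.intervalIntegrable_density v i0 i1).sub
      (hB.intervalIntegrable_density v i0 i1)).const_mul c
  have I3 : IntervalIntegrable (fun t => 2 * b * ((1 - t) * k t - (1 - t) * h t)) volume 0 1 :=
    ((hC.intervalIntegrable_one_sub_mul_density v).sub
      (hB.intervalIntegrable_one_sub_mul_density v)).const_mul _
  have I4 : IntervalIntegrable (fun t => (k t - h t) ^ 2) volume 0 1 :=
    hC.intervalIntegrable_density_sub_sq hB v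
  have hmono : ∫ t in (0 : ℝ)..1, (h t ^ 2 + (c * (k t - h t)
      + (2 * b * ((1 - t) * k t - (1 - t) * h t) + (k t - h t) ^ 2))) ≤
      ∫ t in (0 : ℝ)..1, k t ^ 2 := by
    refine intervalIntegral.integral_mono_on_of_le_Ioo zero_le_one
      (I1.add (I2.add (I3.add I4))) (hC.intervalIntegrable_density_sq v i0 i1) fun t ht => ?_
    have := sq_sub_clampedRamp_le b (bandMax b v) t (hC.copulaDensity_nonneg v t)
      (hC.copulaDensity_le_one v t)
    rw [hh, copulaDensity_bandCopulaPos b hv ht, bandDensity, hc, hk]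
    linarith
  rw [intervalIntegral.integral_add I1 (I2.add (I3.add I4)),
    intervalIntegral.integral_add I2 (I3.add I4), intervalIntegral.integral_add I3 I4,
    intervalIntegral.integral_const_mul, intervalIntegral.integral_const_mul,
    intervalIntegral.integral_sub (hC.intervalIntegrable_density v i0 i1)
      (hB.intervalIntegrable_density v i0 i1),
    intervalIntegral.integral_sub (hC.intervalIntegrable_one_sub_mul_density v)
      (hB.intervalIntegrable_one_sub_mul_density v),
    hC.integral_copulaDensity i1 hv, hB.integral_copulaDensity i1 hv,
    hC.marginal_left v hv, hB.marginal_left v hv, sub_self, mul_zero, zero_add] at hmono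
  exact hmono

/-- The band copula of parameter `b` maximizes `ρ - ξ / b`, with a quadratic remainder. -/
theorem support (hC : IsCopula C) {b : ℝ} (hb : 0 < b) :
    b * (spearmanRho C - spearmanRho (bandCopulaPos b))
      + 6 * (∫ v in (0 : ℝ)..1, ∫ t in (0 : ℝ)..1,
        (copulaDensity C v t - copulaDensity (bandCopulaPos b) v t) ^ 2)
      ≤ chatterjeeXi C - chatterjeeXi (bandCopulaPos b) := by
  have hB := isCopula_bandCopulaPos hb
  have I1 := hB.intervalIntegrable_integral_sq 0 1
  have I2 := hC.intervalIntegrable_integral_one_sub_mul 0 1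
  have I3 := hB.intervalIntegrable_integral_one_sub_mul 0 1
  have I4 := hC.intervalIntegrable_integral_sub_sq hB 0 1
  have := intervalIntegral.integral_mono_on zero_le_one
    (I1.add (((I2.sub I3).const_mul (2 * b)).add I4)) (hC.intervalIntegrable_integral_sq 0 1)
    fun v hv => hC.section_support hb hv
  rw [intervalIntegral.integral_add I1 (((I2.sub I3).const_mul (2 * b)).add I4),
    intervalIntegral.integral_add ((I2.sub I3).const_mul (2 * b)) I4,
    intervalIntegral.integral_const_mul, intervalIntegral.integral_sub I2 I3] at this
  rw [hC.spearmanRho_eq, hB.spearmanRho_eq, chatterjeeXi_eq, chatterjeeXi_eq]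
  linarith

/-- Copulas whose first partial derivatives have `L²` distance zero agree. -/
theorem eq_of_integral_sub_sq_eq_zero (hC : IsCopula C) (hD : IsCopula D)
    (h : ∫ v in (0 : ℝ)..1, ∫ t in (0 : ℝ)..1,
      (copulaDensity C v t - copulaDensity D v t) ^ 2 = 0) :
    ∀ u ∈ Icc (0 : ℝ) 1, ∀ v ∈ Icc (0 : ℝ) 1, C u v = D u v := by
  intro u hu
  rw [intervalIntegral.integral_eq_zero_iff_of_nonneg_ae
    (.of_forall fun v => integral_density_sub_sq_nonneg C D v)
    (hC.intervalIntegrable_integral_sub_sq hD 0 1), Ioc_eq_empty_of_le (zero_le_one' ℝ),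
    union_empty] at h
  -- For almost every `v` the densities agree almost everywhere, hence so do their integrals up to
  -- `u`; continuity in `v` then removes the exceptional set.
  have hae : C u =ᵐ[volume.restrict (Icc 0 1)] D u := by
    rw [← restrict_Ioc_eq_restrict_Icc]
    filter_upwards [h, ae_restrict_mem measurableSet_Ioc] with v hv hvm
    have hvm := Ioc_subset_Icc_self hvm
    simp only [Pi.zero_apply] at hv
    rw [intervalIntegral.integral_eq_zero_iff_of_nonneg_ae (.of_forall fun t => sq_nonneg _)
      (hC.intervalIntegrable_density_sub_sq hD v), Ioc_eq_empty_of_le (zero_le_one' ℝ),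
      union_empty] at hv
    rw [← hC.integral_copulaDensity hu hvm, ← hD.integral_copulaDensity hu hvm]
    refine intervalIntegral.integral_congr_ae ?_
    rw [uIoc_of_le hu.1]
    filter_upwards [(ae_restrict_iff' measurableSet_Ioc).1 hv] with t ht htu
    exact sub_eq_zero.1 (pow_eq_zero_iff two_ne_zero |>.1 (ht ⟨htu.1, htu.2.trans hu.2⟩))
  have hcont : ∀ {E : ℝ → ℝ → ℝ}, IsCopula E → ContinuousOn (E u) (Icc 0 1) := fun hE =>
    hE.continuousOn.comp (continuousOn_const.prodMk continuousOn_id) fun v hv => ⟨hu, hv⟩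
  exact Measure.eqOn_Icc_of_ae_eq volume zero_ne_one hae (hcont hC) (hcont hD)

theorem eq_bandCopulaPos (hC : IsCopula C) {b : ℝ} (hb : 0 < b)
    (hxi : chatterjeeXi C = chatterjeeXi (bandCopulaPos b))
    (hrho : spearmanRho C = spearmanRho (bandCopulaPos b)) :
    ∀ u ∈ Icc (0 : ℝ) 1, ∀ v ∈ Icc (0 : ℝ) 1, C u v = bandCopulaPos b u v := by
  refine hC.eq_of_integral_sub_sq_eq_zero (isCopula_bandCopulaPos hb) (le_antisymm ?_ ?_)
  · have := hC.support hb
    rw [hxi, hrho] at this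
    linarith
  · exact intervalIntegral.integral_nonneg zero_le_one fun v _ =>
      integral_density_sub_sq_nonneg _ _ v

theorem spearmanRho_le (hC : IsCopula C) {b : ℝ} (hb : 0 < b) :
    spearmanRho C ≤ spearmanRho (bandCopulaPos b)
      + (chatterjeeXi C - chatterjeeXi (bandCopulaPos b)) / b := by
  have h1 := hC.support hb
  have h2 : 0 ≤ ∫ v in (0 : ℝ)..1, ∫ t in (0 : ℝ)..1,
      (copulaDensity C v t - copulaDensity (bandCopulaPos b) v t) ^ 2 :=
    intervalIntegral.integral_nonneg zero_le_one fun v _ => integral_density_sub_sq_nonneg _ _ v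
  rw [← sub_le_iff_le_add', le_div_iff₀ hb]
  linarith

/-- Expanding `(h - v)² ≥ 0` bounds each section's second moment below by `v²`, and `6 · 1/3 - 2 =
0`. -/
theorem chatterjeeXi_nonneg (hC : IsCopula C) : 0 ≤ chatterjeeXi C := by
  have hsec : ∀ v ∈ Icc (0 : ℝ) 1, v ^ 2 ≤ ∫ t in (0 : ℝ)..1, copulaDensity C v t ^ 2 := by
    intro v hv
    have i0 : (0 : ℝ) ∈ Icc (0 : ℝ) 1 := by simp
    have i1 : (1 : ℝ) ∈ Icc (0 : ℝ) 1 := by simp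
    have I := (hC.intervalIntegrable_density v i0 i1).const_mul (2 * v)
    have := intervalIntegral.integral_mono zero_le_one
      (I.sub (intervalIntegrable_const (c := v ^ 2))) (hC.intervalIntegrable_density_sq v i0 i1)
      fun t => by nlinarith [sq_nonneg (copulaDensity C v t - v)]
    rw [intervalIntegral.integral_sub I intervalIntegrable_const,
      intervalIntegral.integral_const_mul, hC.integral_copulaDensity i1 hv,
      hC.marginal_left v hv] at this
    simp only [intervalIntegral.integral_const, sub_zero, smul_eq_mul, one_mul] at this
    linarith
  have := intervalIntegral.integral_mono_on zero_le_one
    (Continuous.intervalIntegrable (by fun_prop) _ _) (hC.intervalIntegrable_integral_sq 0 1) hsec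
  rw [integral_pow] at this
  rw [chatterjeeXi_eq]
  norm_num at this
  linarith

/-- From `0 ≤ h ≤ 1` one has `h² ≤ h`, whose section integral is `v`, and `6 · 1/2 - 2 = 1`. -/
theorem chatterjeeXi_le_one (hC : IsCopula C) : chatterjeeXi C ≤ 1 := by
  have hsec : ∀ v ∈ Icc (0 : ℝ) 1, ∫ t in (0 : ℝ)..1, copulaDensity C v t ^ 2 ≤ v := by
    intro v hv
    have i0 : (0 : ℝ) ∈ Icc (0 : ℝ) 1 := by simp
    have i1 : (1 : ℝ) ∈ Icc (0 : ℝ) 1 := by simp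
    have := intervalIntegral.integral_mono zero_le_one (hC.intervalIntegrable_density_sq v i0 i1)
      (hC.intervalIntegrable_density v i0 i1) fun t => by
        nlinarith [hC.copulaDensity_nonneg v t, hC.copulaDensity_le_one v t]
    rwa [hC.integral_copulaDensity i1 hv, hC.marginal_left v hv] at this
  have := intervalIntegral.integral_mono_on zero_le_one (hC.intervalIntegrable_integral_sq 0 1)
    (Continuous.intervalIntegrable (by fun_prop) _ _) hsec
  rw [integral_id] at this
  rw [chatterjeeXi_eq]
  norm_num at this
  linarith

end IsCopula

/-! ### Congruence -/

lemma chatterjeeXi_congr {C D : ℝ → ℝ → ℝ}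
    (h : ∀ u ∈ Icc (0 : ℝ) 1, ∀ v ∈ Icc (0 : ℝ) 1, C u v = D u v) :
    chatterjeeXi C = chatterjeeXi D := by
  have : squareExtension C = squareExtension D :=
    funext₂ fun u v => h _ (unitClamp_mem u) _ (unitClamp_mem v)
  simp only [IsCopula.chatterjeeXi_eq, copulaDensity, this]

lemma spearmanRho_congr {C D : ℝ → ℝ → ℝ}
    (h : ∀ u ∈ Icc (0 : ℝ) 1, ∀ v ∈ Icc (0 : ℝ) 1, C u v = D u v) :
    spearmanRho C = spearmanRho D := by
  unfold spearmanRho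
  rw [setIntegral_congr_fun (measurableSet_Icc.prod measurableSet_Icc)
    fun p hp => h p.1 hp.1 p.2 hp.2]

/-- The values of a copula lie in `[0,1]` as soon as the other properties hold. -/
lemma IsCopula.of_two_increasing {C : ℝ → ℝ → ℝ}
    (gl : ∀ v ∈ Icc (0 : ℝ) 1, C 0 v = 0) (gr : ∀ u ∈ Icc (0 : ℝ) 1, C u 0 = 0)
    (ml : ∀ v ∈ Icc (0 : ℝ) 1, C 1 v = v) (mr : ∀ u ∈ Icc (0 : ℝ) 1, C u 1 = u)
    (ti : ∀ u ∈ Icc (0 : ℝ) 1, ∀ u' ∈ Icc (0 : ℝ) 1, ∀ v ∈ Icc (0 : ℝ) 1,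
      ∀ v' ∈ Icc (0 : ℝ) 1, u ≤ u' → v ≤ v' → 0 ≤ C u v + C u' v' - C u v' - C u' v) :
    IsCopula C := by
  refine ⟨fun u hu v hv => ?_, gl, gr, ml, mr, ti⟩
  have i0 : (0 : ℝ) ∈ Icc (0 : ℝ) 1 := by simp
  have i1 : (1 : ℝ) ∈ Icc (0 : ℝ) 1 := by simp
  have h1 := ti 0 i0 u hu 0 i0 v hv hu.1 hv.1
  have h2 := ti u hu 1 i1 0 i0 v hv hu.2 hv.1
  rw [gl 0 i0, gl v hv, gr u hu] at h1
  rw [gr u hu, gr 1 i1, ml v hv] at h2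
  exact ⟨by linarith, by linarith [hv.2]⟩

/-! ### Partial reflections -/

/-- The copula obtained by reversing the first coordinate on `[θ, 1]`. -/
def partialReflection (C : ℝ → ℝ → ℝ) (θ u v : ℝ) : ℝ :=
  squareExtension C (min u θ) v + v - squareExtension C (1 + θ - max u θ) v

section Reflection

variable {C : ℝ → ℝ → ℝ} {θ : ℝ}

lemma partialReflection_of_le (hC : IsCopula C) (hθ : θ ∈ Icc (0 : ℝ) 1) {u v : ℝ} (h0 : 0 ≤ u)
    (hu : u ≤ θ) (hv : v ∈ Icc (0 : ℝ) 1) : partialReflection C θ u v = C u v := by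
  rw [partialReflection, min_eq_left hu, max_eq_right hu, add_sub_cancel_right,
    squareExtension_of_mem C ⟨h0, hu.trans hθ.2⟩ hv, squareExtension_of_mem C (by simp) hv,
    hC.marginal_left v hv]
  ring

lemma partialReflection_of_ge (hθ : θ ∈ Icc (0 : ℝ) 1) {u v : ℝ} (h1 : u ≤ 1)
    (hu : θ ≤ u) (hv : v ∈ Icc (0 : ℝ) 1) :
    partialReflection C θ u v = C θ v + v - C (1 + θ - u) v := by
  rw [partialReflection, min_eq_right hu, max_eq_left hu, squareExtension_of_mem C hθ hv,
    squareExtension_of_mem C ⟨by linarith [hθ.1], by linarith⟩ hv]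

/-- In `u`, `min u θ` increases and `1 + θ - max u θ` decreases, so the volume of a rectangle is a
sum of two `C`-volumes. The margin at `v = 1` is `min u θ + max u θ = u + θ`. -/
lemma isCopula_partialReflection (hC : IsCopula C) (hθ : θ ∈ Icc (0 : ℝ) 1) :
    IsCopula (partialReflection C θ) := by
  have i0 : (0 : ℝ) ∈ Icc (0 : ℝ) 1 := by simp
  have i1 : (1 : ℝ) ∈ Icc (0 : ℝ) 1 := by simp
  have hmin : ∀ u ∈ Icc (0 : ℝ) 1, min u θ ∈ Icc (0 : ℝ) 1 := fun u hu =>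
    ⟨le_min hu.1 hθ.1, (min_le_left _ _).trans hu.2⟩
  have hmax : ∀ u ∈ Icc (0 : ℝ) 1, 1 + θ - max u θ ∈ Icc (0 : ℝ) 1 := fun u hu =>
    ⟨by linarith [max_le hu.2 hθ.2, hθ.1], by linarith [le_max_right u θ]⟩
  have he : ∀ u ∈ Icc (0 : ℝ) 1, ∀ v ∈ Icc (0 : ℝ) 1,
      partialReflection C θ u v = C (min u θ) v + v - C (1 + θ - max u θ) v := fun u hu v hv => by
    rw [partialReflection, squareExtension_of_mem C (hmin u hu) hv,
      squareExtension_of_mem C (hmax u hu) hv]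
  refine IsCopula.of_two_increasing (fun v hv => ?_) (fun u hu => ?_) (fun v hv => ?_)
    (fun u hu => ?_) fun u hu u' hu' v hv v' hv' huu hvv => ?_
  · rw [partialReflection_of_le hC hθ le_rfl hθ.1 hv, hC.grounded_left v hv]
  · rw [he u hu 0 i0, hC.grounded_right _ (hmin u hu), hC.grounded_right _ (hmax u hu)]
    ring
  · rw [partialReflection_of_ge hθ le_rfl hθ.2 hv, add_sub_cancel_left]
    ring
  · rw [he u hu 1 i1, hC.marginal_right _ (hmin u hu), hC.marginal_right _ (hmax u hu)]
    linarith [min_add_max u θ]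
  · have h1 := hC.two_increasing _ (hmin u hu) _ (hmin u' hu') v hv v' hv'
      (min_le_min_right _ huu) hvv
    have h2 := hC.two_increasing _ (hmax u' hu') _ (hmax u hu) v hv v' hv'
      (by linarith [max_le_max_right θ huu]) hvv
    rw [he u hu v hv, he u' hu' v' hv', he u hu v' hv', he u' hu' v hv]
    linarith

/-- Each section of the density is rearranged by the measure-preserving reversal `t ↦ 1 + θ - t` of
`[θ,1]`, which leaves its second moment unchanged. -/
lemma chatterjeeXi_partialReflection (hC : IsCopula C) (hθ : θ ∈ Icc (0 : ℝ) 1) :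
    chatterjeeXi (partialReflection C θ) = chatterjeeXi C := by
  have i0 : (0 : ℝ) ∈ Icc (0 : ℝ) 1 := by simp
  have i1 : (1 : ℝ) ∈ Icc (0 : ℝ) 1 := by simp
  have hR := isCopula_partialReflection hC hθ
  rw [IsCopula.chatterjeeXi_eq, IsCopula.chatterjeeXi_eq]
  congr 2
  refine intervalIntegral.integral_congr fun v hv => ?_
  rw [uIcc_of_le zero_le_one] at hv
  have hlow : EqOn (fun t => copulaDensity (partialReflection C θ) v t ^ 2)
      (fun t => copulaDensity C v t ^ 2) (Ioo 0 θ) := by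
    intro t ht
    have ht' : t ∈ Ioo (0 : ℝ) 1 := ⟨ht.1, ht.2.trans_le hθ.2⟩
    simp only
    rw [copulaDensity_eq_deriv _ hv ht', copulaDensity_eq_deriv _ hv ht']
    congr 1
    refine Filter.EventuallyEq.deriv_eq ?_
    filter_upwards [isOpen_Ioo.mem_nhds ht] with s hs
    exact partialReflection_of_le hC hθ hs.1.le hs.2.le hv
  have hhigh : EqOn (fun t => copulaDensity (partialReflection C θ) v t ^ 2)
      (fun t => copulaDensity C v (1 + θ - t) ^ 2) (Ioo θ 1) := by
    intro t ht
    have ht' : t ∈ Ioo (0 : ℝ) 1 := ⟨hθ.1.trans_lt ht.1, ht.2⟩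
    have ht'' : 1 + θ - t ∈ Ioo (0 : ℝ) 1 := ⟨by linarith [ht.2, hθ.1], by linarith [ht.1]⟩
    simp only
    rw [copulaDensity_eq_deriv _ hv ht', copulaDensity_eq_deriv _ hv ht'']
    have e : (fun s => partialReflection C θ s v) =ᶠ[nhds t]
        fun s => C θ v + v - (fun x => C x v) (1 + θ - s) := by
      filter_upwards [isOpen_Ioo.mem_nhds ht] with s hs
      exact partialReflection_of_ge hθ hs.2.le hs.1.le hv
    rw [e.deriv_eq, deriv_const_sub, deriv_comp_const_sub (fun x => C x v), neg_neg]
  rw [← intervalIntegral.integral_add_adjacent_intervals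
      (hR.intervalIntegrable_density_sq v i0 hθ) (hR.intervalIntegrable_density_sq v hθ i1),
    ← intervalIntegral.integral_add_adjacent_intervals
      (hC.intervalIntegrable_density_sq v i0 hθ) (hC.intervalIntegrable_density_sq v hθ i1),
    intervalIntegral.integral_congr_Ioo_of_le hθ.1 hlow,
    intervalIntegral.integral_congr_Ioo_of_le hθ.2 hhigh,
    intervalIntegral.integral_comp_sub_left (fun t => copulaDensity C v t ^ 2) (1 + θ)]
  simp

lemma continuous_spearmanRho_partialReflection (hC : IsCopula C) :
    Continuous fun θ => spearmanRho (partialReflection C θ) := by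
  unfold spearmanRho
  refine (continuous_const.mul ?_).sub continuous_const
  refine continuous_parametric_integral_of_continuous (f := fun θ (p : ℝ × ℝ) =>
    partialReflection C θ p.1 p.2) ?_ (isCompact_Icc.prod isCompact_Icc)
  have hc := hC.continuous_squareExtension
  have h1 : Continuous fun q : ℝ × ℝ × ℝ => squareExtension C (min q.2.1 q.1) q.2.2 :=
    hc.comp (by fun_prop : Continuous fun q : ℝ × ℝ × ℝ => (min q.2.1 q.1, q.2.2))
  have h2 : Continuous fun q : ℝ × ℝ × ℝ => squareExtension C (1 + q.1 - max q.2.1 q.1) q.2.2 :=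
    hc.comp (by fun_prop : Continuous fun q : ℝ × ℝ × ℝ => (1 + q.1 - max q.2.1 q.1, q.2.2))
  exact (h1.add (by fun_prop)).sub h2

/-- The copula obtained by reversing the first coordinate. -/
def reflection (C : ℝ → ℝ → ℝ) (u v : ℝ) : ℝ := v - C (1 - u) v

lemma partialReflection_zero (hC : IsCopula C) :
    ∀ u ∈ Icc (0 : ℝ) 1, ∀ v ∈ Icc (0 : ℝ) 1, partialReflection C 0 u v = reflection C u v := by
  intro u hu v hv
  rw [partialReflection_of_ge (by simp) hu.2 hu.1 hv, hC.grounded_left v hv, zero_add, add_zero,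
    reflection]

lemma partialReflection_one (hC : IsCopula C) :
    ∀ u ∈ Icc (0 : ℝ) 1, ∀ v ∈ Icc (0 : ℝ) 1, partialReflection C 1 u v = C u v :=
  fun _ hu _ hv => partialReflection_of_le hC (by simp) hu.1 hu.2 hv

lemma isCopula_reflection (hC : IsCopula C) : IsCopula (reflection C) := by
  have hm : ∀ u ∈ Icc (0 : ℝ) 1, 1 - u ∈ Icc (0 : ℝ) 1 := fun u hu =>
    ⟨by linarith [hu.2], by linarith [hu.1]⟩
  refine IsCopula.of_two_increasing (fun v hv => ?_) (fun u hu => ?_) (fun v hv => ?_)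
    (fun u hu => ?_) fun u hu u' hu' v hv v' hv' huu hvv => ?_
  · simp [reflection, hC.marginal_left v hv]
  · simp [reflection, hC.grounded_right _ (hm u hu)]
  · simp [reflection, hC.grounded_left v hv]
  · simp [reflection, hC.marginal_right _ (hm u hu)]
  · have := hC.two_increasing _ (hm u' hu') _ (hm u hu) v hv v' hv' (by linarith) hvv
    simp only [reflection]
    linarith

lemma chatterjeeXi_reflection (hC : IsCopula C) : chatterjeeXi (reflection C) = chatterjeeXi C := by
  rw [← chatterjeeXi_congr (partialReflection_zero hC),
    chatterjeeXi_partialReflection hC (by simp)]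

lemma spearmanRho_reflection (hC : IsCopula C) : spearmanRho (reflection C) = -spearmanRho C := by
  have hI : IntervalIntegrable (fun v => ∫ u in (0 : ℝ)..1, C u v) volume 0 1 := by
    refine (hC.intervalIntegrable_integral_one_sub_mul 0 1).congr fun v hv => ?_
    rw [uIoc_of_le zero_le_one] at hv
    exact hC.integral_one_sub_mul_copulaDensity (Ioc_subset_Icc_self hv)
  have e : ∀ v ∈ uIcc (0 : ℝ) 1, ∫ u in (0 : ℝ)..1, reflection C u v =
      v - ∫ u in (0 : ℝ)..1, C u v := by
    intro v hv
    rw [uIcc_of_le zero_le_one] at hv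
    have hc : IntervalIntegrable (fun u => C u v) volume 0 1 := by
      refine ContinuousOn.intervalIntegrable ?_
      rw [uIcc_of_le zero_le_one]
      exact hC.continuousOn.comp (continuousOn_id.prodMk continuousOn_const)
        fun u hu => ⟨hu, hv⟩
    have h := intervalIntegral.integral_comp_sub_left (a := 0) (b := 1) (fun u => v - C u v) 1
    simp only [sub_self, sub_zero] at h
    simp only [reflection]
    rw [h, intervalIntegral.integral_sub intervalIntegrable_const hc]
    simp
  rw [spearmanRho, spearmanRho, (isCopula_reflection hC).setIntegral_eq, hC.setIntegral_eq,
    intervalIntegral.integral_congr e, intervalIntegral.integral_sub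
      (Continuous.intervalIntegrable (by fun_prop) _ _) hI, integral_id]
  ring

theorem IsCopula.abs_spearmanRho_le (hC : IsCopula C) {b : ℝ} (hb : 0 < b) :
    |spearmanRho C| ≤ spearmanRho (bandCopulaPos b)
      + (chatterjeeXi C - chatterjeeXi (bandCopulaPos b)) / b := by
  have h := (isCopula_reflection hC).spearmanRho_le hb
  rw [spearmanRho_reflection hC, chatterjeeXi_reflection hC] at h
  exact abs_le'.2 ⟨hC.spearmanRho_le hb, h⟩

/-- All values between `-ρ(C)` and `ρ(C)` are attained with the same `ξ`. -/
theorem IsCopula.exists_of_abs_le (hC : IsCopula C) {y : ℝ} (hy : |y| ≤ spearmanRho C) :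
    ∃ D, IsCopula D ∧ chatterjeeXi D = chatterjeeXi C ∧ spearmanRho D = y := by
  have h0 : spearmanRho (partialReflection C 0) = -spearmanRho C := by
    rw [spearmanRho_congr (partialReflection_zero hC), spearmanRho_reflection hC]
  have h1 : spearmanRho (partialReflection C 1) = spearmanRho C :=
    spearmanRho_congr (partialReflection_one hC)
  obtain ⟨θ, hθ, h⟩ := intermediate_value_Icc (zero_le_one' ℝ)
    (continuous_spearmanRho_partialReflection hC).continuousOn
    (show y ∈ Icc _ _ by rw [h0, h1]; exact abs_le.1 hy)
  exact ⟨_, isCopula_partialReflection hC hθ, chatterjeeXi_partialReflection hC hθ, h⟩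

end Reflection

/-! ### The parameter of the extremal copula -/

/-- With `y = √(6x)` and `b = y/(2c)`, the cubic `b²/2 - b³/5 = x` becomes `4c³ - 3c = -3y/5`, which
the triple-angle formula solves by `c = cos θ`. -/
lemma bParam_of_le {x : ℝ} (h0 : 0 < x) (hx : x ≤ 3 / 10) :
    0 < bParam x ∧ bParam x ≤ 1 ∧ bParam x ^ 2 / 2 - bParam x ^ 3 / 5 = x := by
  have hy0 : 0 < √(6 * x) := Real.sqrt_pos.2 (by linarith)
  have hysq : √(6 * x) ^ 2 = 6 * x := Real.sq_sqrt (by linarith)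
  rw [bParam, if_pos hx]
  set y := √(6 * x) with hy
  -- A rational bound for `√(9/5)`; it puts `-3y/5` in the domain of `arccos` and, as `2c ≥ 1`, also
  -- bounds `b`.
  have hy1 : y ≤ 27 / 20 := by nlinarith
  set θ := 1 / 3 * Real.arccos (-(3 * y / 5)) with hθ
  have hcos : 4 * Real.cos θ ^ 3 - 3 * Real.cos θ = -(3 * y / 5) := by
    rw [← Real.cos_three_mul, hθ, show 3 * (1 / 3 * Real.arccos (-(3 * y / 5))) =
      Real.arccos (-(3 * y / 5)) by ring, Real.cos_arccos (by linarith) (by linarith)]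
  have hc : 1 / 2 ≤ Real.cos θ := by
    rw [← Real.cos_pi_div_three]
    have h1 := Real.arccos_nonneg (-(3 * y / 5))
    have h2 := Real.arccos_le_pi (-(3 * y / 5))
    exact Real.cos_le_cos_of_nonneg_of_le_pi (by linarith) (by linarith [Real.pi_pos])
      (by linarith)
  generalize Real.cos θ = c at hcos hc
  have hc0 : 0 < c := by linarith
  set b := y / (2 * c) with hb
  have hb0 : 0 < b := by positivity
  have hyb : y = 2 * c * b := by rw [hb]; field_simp
  have hc2 : 4 * c ^ 2 = 3 - 6 * b / 5 := by
    have : c * (4 * c ^ 2) = c * (3 - 6 * b / 5) := by rw [hyb] at hcos; linarith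
    exact mul_left_cancel₀ hc0.ne' this
  have hxb : b ^ 2 / 2 - b ^ 3 / 5 = x := by
    have : 6 * x = b ^ 2 * (4 * c ^ 2) := by rw [← hysq, hyb]; ring
    rw [hc2] at this
    linarith
  refine ⟨hb0, le_of_not_gt fun h => ?_, hxb⟩
  have hb1 : b ≤ 27 / 20 := by nlinarith
  -- This product is `b²/2 - b³/5 - 3/10 = x - 3/10`, so `b > 1` would contradict `x ≤ 3/10`.
  have : 0 < (b - 1) * (-(b ^ 2) / 5 + 3 * b / 10 + 3 / 10) :=
    mul_pos (by linarith) (by nlinarith)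
  linarith

/-- Here `bParam x` is the larger root of `(1 - x)b² - b + 3/10 = 0`. -/
lemma bParam_of_gt {x : ℝ} (hx : 3 / 10 < x) (h1 : x < 1) :
    1 ≤ bParam x ∧ 1 - 1 / bParam x + 3 / (10 * bParam x ^ 2) = x := by
  rw [bParam, if_neg hx.not_ge]
  have hrsq : √(5 * (6 * x - 1)) ^ 2 = 5 * (6 * x - 1) := Real.sq_sqrt (by linarith)
  have hr : 2 ≤ √(5 * (6 * x - 1)) := Real.le_sqrt_of_sq_le (by linarith)
  generalize √(5 * (6 * x - 1)) = r at hrsq hr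
  have hx' : 0 < 1 - x := by linarith
  have hb : 1 ≤ (5 + r) / (10 * (1 - x)) := by
    rw [le_div_iff₀ (by linarith)]; linarith
  refine ⟨hb, ?_⟩
  have hxr : x = (r ^ 2 + 5) / 30 := by linarith
  have hr5 : 0 < 5 + r := by linarith
  field_simp
  rw [hxr]
  ring

lemma bParam_pos {x : ℝ} (hx : x ∈ Ioo (0 : ℝ) 1) : 0 < bParam x := by
  rcases le_or_gt x (3 / 10) with h | h
  · exact (bParam_of_le hx.1 h).1
  · linarith [(bParam_of_gt h hx.2).1]

theorem chatterjeeXi_bParam {x : ℝ} (hx : x ∈ Ioo (0 : ℝ) 1) :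
    chatterjeeXi (bandCopulaPos (bParam x)) = x := by
  rcases le_or_gt x (3 / 10) with h | h
  · obtain ⟨h0, h1, h2⟩ := bParam_of_le hx.1 h
    rw [chatterjeeXi_band_of_le_one h0 h1, h2]
  · obtain ⟨h1, h2⟩ := bParam_of_gt h hx.2
    rw [chatterjeeXi_band_of_one_le h1, h2]

theorem spearmanRho_bParam {x : ℝ} (hx : x ∈ Ioo (0 : ℝ) 1) :
    spearmanRho (bandCopulaPos (bParam x)) = maxRho x := by
  rw [maxRho, if_neg hx.1.ne']
  rcases le_or_gt x (3 / 10) with h | h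
  · obtain ⟨h0, h1, -⟩ := bParam_of_le hx.1 h
    rw [spearmanRho_band_of_le_one h0 h1, if_pos h]
  · rw [spearmanRho_band_of_one_le (bParam_of_gt h hx.2).1, if_neg h.not_ge, if_pos hx.2]

lemma maxRho_zero : maxRho 0 = 0 := if_pos rfl

lemma maxRho_one : maxRho 1 = 1 := by norm_num [maxRho]

lemma chatterjeeXi_band_mem {b : ℝ} (hb : 0 < b) :
    chatterjeeXi (bandCopulaPos b) ∈ Ioo (0 : ℝ) 1 := by
  rcases le_total b 1 with h | h
  · rw [chatterjeeXi_band_of_le_one hb h]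
    have h2 : 0 < b ^ 2 := by positivity
    constructor <;> nlinarith
  · rw [chatterjeeXi_band_of_one_le h]
    have hw0 : 0 < 1 / b := by positivity
    have hw1 : 1 / b ≤ 1 := (div_le_one hb).2 h
    rw [show 3 / (10 * b ^ 2) = 3 / 10 * (1 / b) ^ 2 by field_simp]
    constructor <;> nlinarith

lemma spearmanRho_band_pos {b : ℝ} (hb : 0 < b) : 0 < spearmanRho (bandCopulaPos b) := by
  rcases le_total b 1 with h | h
  · rw [spearmanRho_band_of_le_one hb h]
    nlinarith
  · rw [spearmanRho_band_of_one_le h]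
    have h1 : 1 / (2 * b ^ 2) ≤ 1 / 2 :=
      one_div_le_one_div_of_le two_pos (by nlinarith)
    have : 0 < 1 / (5 * b ^ 3) := by positivity
    linarith

/-! ### The endpoints -/

/-- The band family only attains `0 < ξ < 1`; the product and the minimum supply the points at `ξ =
0` and `ξ = 1`. -/
lemma isCopula_mul : IsCopula fun u v => u * v := by
  refine IsCopula.of_two_increasing (by simp) (by simp) (by simp) (by simp) ?_
  intro u _ u' _ v _ v' _ h h'
  nlinarith [mul_nonneg (sub_nonneg.2 h) (sub_nonneg.2 h')]

lemma chatterjeeXi_mul : chatterjeeXi (fun u v => u * v) = 0 := by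
  have : ∀ v t : ℝ, deriv (fun s => s * v) t = v := fun v t => by
    simp
  simp only [chatterjeeXi, this, intervalIntegral.integral_const, integral_pow, sub_zero, one_smul]
  norm_num

lemma spearmanRho_mul : spearmanRho (fun u v => u * v) = 0 := by
  rw [spearmanRho, isCopula_mul.setIntegral_eq]
  simp only [intervalIntegral.integral_mul_const, integral_id]
  rw [intervalIntegral.integral_const_mul, integral_id]
  norm_num

lemma isCopula_min : IsCopula fun u v => min u v := by
  refine IsCopula.of_two_increasing (fun v hv => min_eq_left hv.1) (fun u hu => min_eq_right hu.1)
    (fun v hv => min_eq_right hv.2) (fun u hu => min_eq_left hu.2) ?_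
  intro u _ u' _ v _ v' _ h h'
  simp only [min_def]
  split_ifs <;> linarith

lemma chatterjeeXi_min : chatterjeeXi (fun u v => min u v) = 1 := by
  have hsec : ∀ v ∈ uIcc (0 : ℝ) 1, ∫ t in (0 : ℝ)..1, deriv (fun s => min s v) t ^ 2 = v := by
    intro v hv
    rw [uIcc_of_le zero_le_one] at hv
    have hl : EqOn (fun t => deriv (fun s => min s v) t ^ 2) (fun _ => 1) (Ioo 0 v) := by
      intro t ht
      have : (fun s => min s v) =ᶠ[nhds t] fun s => s := by
        filter_upwards [isOpen_Iio.mem_nhds ht.2] with s hs using min_eq_left (le_of_lt hs)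
      simp [this.deriv_eq]
    have hr : EqOn (fun t => deriv (fun s => min s v) t ^ 2) (fun _ => 0) (Ioo v 1) := by
      intro t ht
      have : (fun s => min s v) =ᶠ[nhds t] fun _ => v := by
        filter_upwards [isOpen_Ioi.mem_nhds ht.1] with s hs using min_eq_right (le_of_lt hs)
      simp [this.deriv_eq]
    have hi : ∀ {a b c : ℝ}, a ≤ b → EqOn (fun t => deriv (fun s => min s v) t ^ 2)
        (fun _ => c) (Ioo a b) →
        IntervalIntegrable (fun t => deriv (fun s => min s v) t ^ 2) volume a b := by
      intro a b c hab h
      rw [intervalIntegrable_iff_integrableOn_Ioo_of_le hab]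
      exact (integrableOn_congr_fun h measurableSet_Ioo).2 (by simp)
    rw [← intervalIntegral.integral_add_adjacent_intervals (hi hv.1 hl) (hi hv.2 hr),
      intervalIntegral.integral_congr_Ioo_of_le hv.1 hl,
      intervalIntegral.integral_congr_Ioo_of_le hv.2 hr]
    simp
  rw [chatterjeeXi, intervalIntegral.integral_congr hsec, integral_id]
  norm_num

lemma spearmanRho_min : spearmanRho (fun u v => min u v) = 1 := by
  have hsec : ∀ v ∈ uIcc (0 : ℝ) 1, ∫ u in (0 : ℝ)..1, min u v = 0 + 1 * v + -(1 / 2) * v ^ 2 := by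
    intro v hv
    rw [uIcc_of_le zero_le_one] at hv
    have hi : ∀ a b : ℝ, IntervalIntegrable (fun u => min u v) volume a b := fun a b =>
      Continuous.intervalIntegrable (by fun_prop) _ _
    rw [← intervalIntegral.integral_add_adjacent_intervals (hi 0 v) (hi v 1),
      intervalIntegral.integral_congr_Ioo_of_le hv.1 (g := fun u => u)
        fun u hu => min_eq_left hu.2.le,
      intervalIntegral.integral_congr_Ioo_of_le hv.2 (g := fun _ => v)
        fun u hu => min_eq_right hu.1.le, integral_id, intervalIntegral.integral_const, smul_eq_mul]
    ring
  rw [spearmanRho, isCopula_min.setIntegral_eq, intervalIntegral.integral_congr hsec,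
    integral_quadratic]
  norm_num

/-- The supporting lines for large `b`: their excess over 1 is at most `1/b`. -/
lemma IsCopula.abs_spearmanRho_le_one {C : ℝ → ℝ → ℝ} (hC : IsCopula C) : |spearmanRho C| ≤ 1 := by
  refine le_of_forall_pos_le_add fun ε hε => ?_
  set b := max 1 (1 / ε) with hb
  have hb1 : 1 ≤ b := le_max_left _ _
  have hb0 : 0 < b := by linarith
  have hbe : 1 / b ≤ ε := by
    rw [div_le_iff₀ hb0, mul_comm, ← div_le_iff₀ hε]
    exact le_max_right _ _
  have h := hC.abs_spearmanRho_le hb0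
  have hx : chatterjeeXi C - chatterjeeXi (bandCopulaPos b) ≤ 1 / b := by
    have h1 : 0 ≤ 3 / (10 * b ^ 2) := by positivity
    rw [chatterjeeXi_band_of_one_le hb1]
    linarith [hC.chatterjeeXi_le_one]
  have hd : (chatterjeeXi C - chatterjeeXi (bandCopulaPos b)) / b ≤ 1 / b :=
    (div_le_div_of_nonneg_right hx hb0.le).trans
      (div_le_self (by positivity) hb1)
  have hr : spearmanRho (bandCopulaPos b) ≤ 1 := by
    rw [spearmanRho_band_of_one_le hb1]
    have : 1 / (5 * b ^ 3) ≤ 1 / (2 * b ^ 2) :=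
      one_div_le_one_div_of_le (by positivity) (by nlinarith [sq_nonneg b])
    linarith
  linarith

/-- The supporting lines for small `b`: at `ξ = 0` they give `|ρ| ≤ ρ(C_b) ≤ b`. -/
lemma IsCopula.spearmanRho_eq_zero {C : ℝ → ℝ → ℝ} (hC : IsCopula C) (hx : chatterjeeXi C = 0) :
    spearmanRho C = 0 := by
  refine abs_eq_zero.1 (le_antisymm (le_of_forall_pos_le_add fun ε hε => ?_) (abs_nonneg _))
  set b := min 1 ε with hb
  have hb1 : b ≤ 1 := min_le_left _ _
  have hb0 : 0 < b := lt_min one_pos hε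
  have hbe : b ≤ ε := min_le_right _ _
  have h := hC.abs_spearmanRho_le hb0
  have hd : (chatterjeeXi C - chatterjeeXi (bandCopulaPos b)) / b ≤ 0 :=
    div_nonpos_of_nonpos_of_nonneg (by rw [hx]; linarith [(chatterjeeXi_band_mem hb0).1]) hb0.le
  rw [spearmanRho_band_of_le_one hb0 hb1] at h
  nlinarith [sq_nonneg b]

/-! ### The region -/

/-- The tangent to the upper boundary at `x ∈ (0,1)`. -/
lemma IsCopula.abs_spearmanRho_le_tangent {C : ℝ → ℝ → ℝ} (hC : IsCopula C) {x : ℝ}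
    (hx : x ∈ Ioo (0 : ℝ) 1) : |spearmanRho C| ≤ maxRho x + (chatterjeeXi C - x) / bParam x := by
  have := hC.abs_spearmanRho_le (bParam_pos hx)
  rwa [spearmanRho_bParam hx, chatterjeeXi_bParam hx] at this

lemma IsCopula.abs_spearmanRho_le_maxRho {C : ℝ → ℝ → ℝ} (hC : IsCopula C) :
    |spearmanRho C| ≤ maxRho (chatterjeeXi C) := by
  rcases hC.chatterjeeXi_nonneg.eq_or_lt with h0 | h0
  · rw [hC.spearmanRho_eq_zero h0.symm, ← h0, maxRho_zero, abs_zero]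
  rcases hC.chatterjeeXi_le_one.eq_or_lt with h1 | h1
  · rw [h1, maxRho_one]
    exact hC.abs_spearmanRho_le_one
  · simpa using hC.abs_spearmanRho_le_tangent ⟨h0, h1⟩

lemma exists_isCopula_maxRho {x : ℝ} (hx : x ∈ Icc (0 : ℝ) 1) :
    ∃ C, IsCopula C ∧ chatterjeeXi C = x ∧ spearmanRho C = maxRho x := by
  rcases hx.1.eq_or_lt with rfl | h0
  · exact ⟨_, isCopula_mul, chatterjeeXi_mul, spearmanRho_mul.trans maxRho_zero.symm⟩
  rcases hx.2.eq_or_lt with rfl | h1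
  · exact ⟨_, isCopula_min, chatterjeeXi_min, spearmanRho_min.trans maxRho_one.symm⟩
  · exact ⟨_, isCopula_bandCopulaPos (bParam_pos ⟨h0, h1⟩), chatterjeeXi_bParam ⟨h0, h1⟩,
      spearmanRho_bParam ⟨h0, h1⟩⟩

theorem xiRhoRegion_eq :
    xiRhoRegion = {p : ℝ × ℝ | p.1 ∈ Icc (0 : ℝ) 1 ∧ |p.2| ≤ maxRho p.1} := by
  ext ⟨x, y⟩
  constructor
  · rintro ⟨C, hC, h⟩
    obtain ⟨rfl, rfl⟩ := Prod.mk.inj h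
    exact ⟨⟨hC.chatterjeeXi_nonneg, hC.chatterjeeXi_le_one⟩, hC.abs_spearmanRho_le_maxRho⟩
  · rintro ⟨hx, hy⟩
    obtain ⟨C, hC, hxi, hrho⟩ := exists_isCopula_maxRho hx
    obtain ⟨D, hD, h1, h2⟩ := hC.exists_of_abs_le (hy.trans_eq hrho.symm)
    exact ⟨D, hD, by rw [h1, h2, hxi]⟩

lemma abs_le_tangent_of_mem {p : ℝ × ℝ} (hp : p ∈ xiRhoRegion) {x : ℝ} (hx : x ∈ Ioo (0 : ℝ) 1) :
    |p.2| ≤ maxRho x + (p.1 - x) / bParam x := by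
  obtain ⟨C, hC, rfl⟩ := hp
  exact hC.abs_spearmanRho_le_tangent hx

lemma abs_le_one_of_mem {p : ℝ × ℝ} (hp : p ∈ xiRhoRegion) : |p.2| ≤ 1 := by
  obtain ⟨C, hC, rfl⟩ := hp
  exact hC.abs_spearmanRho_le_one

lemma abs_add_mul_le {a b : ℝ} (ha : 0 ≤ a) (hb : 0 ≤ b) (y z : ℝ) :
    |a * y + b * z| ≤ a * |y| + b * |z| := by
  refine (abs_add_le _ _).trans_eq ?_
  rw [abs_mul, abs_mul, abs_of_nonneg ha, abs_of_nonneg hb]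

/-- Averaging the tangent bound taken at the abscissa of the convex combination cancels its linear
term. Abscissas 0 and 1 have no such tangent: at 0 each point has zero weight or zero `ρ`, at 1 the
bound `|ρ| ≤ 1` suffices. -/
theorem convex_xiRhoRegion : Convex ℝ xiRhoRegion := by
  intro p hp q hq a b ha hb hab
  have hp' := xiRhoRegion_eq ▸ hp
  have hq' := xiRhoRegion_eq ▸ hq
  rw [xiRhoRegion_eq]
  have habs := abs_add_mul_le ha hb p.2 q.2
  simp only [mem_ofPred_eq, Prod.fst_add, Prod.snd_add, Prod.smul_fst, Prod.smul_snd, smul_eq_mul]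
  have hm : a * p.1 + b * q.1 ∈ Icc (0 : ℝ) 1 :=
    convex_Icc (0 : ℝ) 1 hp'.1 hq'.1 ha hb hab
  refine ⟨hm, habs.trans ?_⟩
  rcases hm.1.eq_or_lt with h0 | h0
  · rw [← h0, maxRho_zero]
    have key : ∀ {c : ℝ} {r : ℝ × ℝ}, r.1 ∈ Icc (0 : ℝ) 1 ∧ |r.2| ≤ maxRho r.1 → c * r.1 = 0 →
        c * |r.2| = 0 := by
      intro c r hr h
      rcases mul_eq_zero.1 h with h | h
      · rw [h, zero_mul]
      · have h2 := hr.2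
        rw [h, maxRho_zero] at h2
        rw [le_antisymm h2 (abs_nonneg _), mul_zero]
    have h1 := mul_nonneg ha hp'.1.1
    have h2 := mul_nonneg hb hq'.1.1
    rw [key hp' (by linarith), key hq' (by linarith), add_zero]
  rcases hm.2.eq_or_lt with h1 | h1
  · rw [h1, maxRho_one]
    nlinarith [mul_le_mul_of_nonneg_left (abs_le_one_of_mem hp) ha,
      mul_le_mul_of_nonneg_left (abs_le_one_of_mem hq) hb]
  · have e1 := mul_le_mul_of_nonneg_left (abs_le_tangent_of_mem hp ⟨h0, h1⟩) ha
    have e2 := mul_le_mul_of_nonneg_left (abs_le_tangent_of_mem hq ⟨h0, h1⟩) hb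
    set x := a * p.1 + b * q.1 with hx
    have hB := bParam_pos ⟨h0, h1⟩
    have : a * (maxRho x + (p.1 - x) / bParam x) + b * (maxRho x + (q.1 - x) / bParam x) =
        (a + b) * maxRho x + (a * p.1 + b * q.1 - (a + b) * x) / bParam x := by ring
    rw [hab, ← hx] at this
    simp only [one_mul, sub_self, zero_div, add_zero] at this
    linarith

theorem concaveOn_maxRho : ConcaveOn ℝ (Ioo (0 : ℝ) 1) maxRho := by
  have hmem : ∀ x ∈ Ioo (0 : ℝ) 1, (x, maxRho x) ∈ xiRhoRegion := fun x hx => by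
    obtain ⟨C, hC, h1, h2⟩ := exists_isCopula_maxRho (Ioo_subset_Icc_self hx)
    exact ⟨C, hC, by rw [h1, h2]⟩
  refine ⟨convex_Ioo 0 1, fun x hx y hy a b ha hb hab => ?_⟩
  have h := convex_xiRhoRegion (hmem x hx) (hmem y hy) ha hb hab
  rw [xiRhoRegion_eq] at h
  exact (le_abs_self _).trans h.2

/-- Concavity on an open interval gives continuity without inspecting the formula at `x = 3/10`. -/
lemma continuousOn_maxRho : ContinuousOn maxRho (Ioo (0 : ℝ) 1) :=
  concaveOn_maxRho.continuousOn isOpen_Ioo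

lemma mem_interior_of_abs_lt {p : ℝ × ℝ} (hx : p.1 ∈ Ioo (0 : ℝ) 1) (hy : |p.2| < maxRho p.1) :
    p ∈ interior xiRhoRegion := by
  have hc : ContinuousAt maxRho p.1 := continuousOn_maxRho.continuousAt (isOpen_Ioo.mem_nhds hx)
  have hc' : ContinuousAt (fun q : ℝ × ℝ => maxRho q.1) p :=
    ContinuousAt.comp (f := Prod.fst) hc continuousAt_fst
  have ha : ContinuousAt (fun q : ℝ × ℝ => |q.2|) p := by fun_prop
  rw [mem_interior_iff_mem_nhds, xiRhoRegion_eq]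
  filter_upwards [ha.eventually_lt hc' hy,
    (isOpen_Ioo.preimage continuous_fst).mem_nhds (show p ∈ Prod.fst ⁻¹' Ioo (0 : ℝ) 1 from hx)]
    with q h1 h2
  exact ⟨Ioo_subset_Icc_self h2, h1.le⟩

/-- The tangent bounds at `p.1` are closed conditions, so they persist on the closure; closedness of
the region itself is not needed. -/
lemma abs_eq_maxRho_of_mem_frontier {p : ℝ × ℝ} (hp : p ∈ frontier xiRhoRegion)
    (hx : p.1 ∈ Ioo (0 : ℝ) 1) : |p.2| = maxRho p.1 := by
  refine le_antisymm ?_ (le_of_not_gt fun h => hp.2 (mem_interior_of_abs_lt hx h))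
  have hcl : IsClosed {q : ℝ × ℝ | |q.2| ≤ maxRho p.1 + (q.1 - p.1) / bParam p.1} :=
    isClosed_le (by fun_prop) (by fun_prop)
  have : |p.2| ≤ maxRho p.1 + (p.1 - p.1) / bParam p.1 :=
    closure_minimal (fun q hq => abs_le_tangent_of_mem hq hx) hcl hp.1
  simpa using this

/-- Scaling a nonzero `p.2` by `1 + ε` leaves the region along the vertical line through `p`. -/
lemma mem_frontier_of_abs_le {p : ℝ × ℝ} (hp : p ∈ xiRhoRegion) (h0 : p.2 ≠ 0)
    (h : ∀ q ∈ xiRhoRegion, q.1 = p.1 → |q.2| ≤ |p.2|) : p ∈ frontier xiRhoRegion := by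
  refine ⟨subset_closure hp, fun hi => ?_⟩
  have hc : Continuous fun ε : ℝ => (p.1, p.2 * (1 + ε)) := by fun_prop
  have hev : ∀ᶠ ε in nhds (0 : ℝ), (p.1, p.2 * (1 + ε)) ∈ xiRhoRegion :=
    hc.continuousAt.eventually_mem (by simpa using mem_interior_iff_mem_nhds.1 hi)
  obtain ⟨ε, hε, hε0⟩ := ((hev.filter_mono nhdsWithin_le_nhds).and
    (self_mem_nhdsWithin : Ioi (0 : ℝ) ∈ nhdsWithin 0 (Ioi 0))).exists
  have hle := h _ hε rfl
  have hpos := abs_pos.2 h0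
  have hε0 : 0 < ε := hε0
  simp only [abs_mul] at hle
  rw [abs_of_pos (by linarith : 0 < 1 + ε)] at hle
  nlinarith

/-! ### The band family -/

lemma bandCopula_of_pos {b : ℝ} (hb : 0 < b) : bandCopula b = bandCopulaPos b :=
  funext₂ fun _ _ => if_pos hb

lemma bandCopula_neg {b : ℝ} (hb : 0 < b) : bandCopula (-b) = reflection (bandCopulaPos b) :=
  funext₂ fun u v => by rw [bandCopula, if_neg (by linarith), neg_neg, reflection]

lemma isCopula_bandCopula {b : ℝ} (hb : b ≠ 0) : IsCopula (bandCopula b) := by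
  rcases hb.lt_or_gt with h | h
  · rw [← neg_neg b, bandCopula_neg (neg_pos.2 h)]
    exact isCopula_reflection (isCopula_bandCopulaPos (neg_pos.2 h))
  · rw [bandCopula_of_pos h]
    exact isCopula_bandCopulaPos h

lemma chatterjeeXi_bandCopula_neg {b : ℝ} (hb : 0 < b) :
    chatterjeeXi (bandCopula (-b)) = chatterjeeXi (bandCopulaPos b) := by
  rw [bandCopula_neg hb, chatterjeeXi_reflection (isCopula_bandCopulaPos hb)]

lemma spearmanRho_bandCopula_neg {b : ℝ} (hb : 0 < b) :
    spearmanRho (bandCopula (-b)) = -spearmanRho (bandCopulaPos b) := by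
  rw [bandCopula_neg hb, spearmanRho_reflection (isCopula_bandCopulaPos hb)]

/-- The supporting line of parameter `b` gives extremality directly, so `bParam (ξ(C_b)) = b` is
never required. -/
lemma mem_frontier_band {b y : ℝ} (hb : 0 < b) (hy : |y| = spearmanRho (bandCopulaPos b))
    (hm : (chatterjeeXi (bandCopulaPos b), y) ∈ xiRhoRegion) :
    (chatterjeeXi (bandCopulaPos b), y) ∈ frontier xiRhoRegion := by
  refine mem_frontier_of_abs_le hm
    (abs_pos.1 (hy ▸ spearmanRho_band_pos hb)) ?_
  rintro q ⟨C, hC, rfl⟩ hq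
  have := hC.abs_spearmanRho_le hb
  simp only at hq ⊢
  rw [hq, sub_self, zero_div, add_zero] at this
  rwa [hy]

theorem frontier_xiRhoRegion_inter :
    frontier xiRhoRegion ∩ {p : ℝ × ℝ | p.1 ∈ Ioo (0 : ℝ) 1} =
      {p : ℝ × ℝ | ∃ b : ℝ, b ≠ 0 ∧
        p = (chatterjeeXi (bandCopula b), spearmanRho (bandCopula b))} := by
  ext ⟨x, y⟩
  constructor
  · rintro ⟨hp, hx⟩
    have hx : x ∈ Ioo (0 : ℝ) 1 := hx
    have hB := bParam_pos hx
    rcases eq_or_eq_neg_of_abs_eq (abs_eq_maxRho_of_mem_frontier hp hx) with h | h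
    · refine ⟨bParam x, hB.ne', ?_⟩
      rw [bandCopula_of_pos hB, chatterjeeXi_bParam hx, spearmanRho_bParam hx]
      exact Prod.ext rfl h
    · refine ⟨-bParam x, (neg_neg_of_pos hB).ne, ?_⟩
      rw [chatterjeeXi_bandCopula_neg hB, spearmanRho_bandCopula_neg hB, chatterjeeXi_bParam hx,
        spearmanRho_bParam hx]
      exact Prod.ext rfl h
  · rintro ⟨b, hb, h⟩
    rw [h]
    have hm : (chatterjeeXi (bandCopula b), spearmanRho (bandCopula b)) ∈ xiRhoRegion :=
      ⟨_, isCopula_bandCopula hb, rfl⟩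
    rcases hb.lt_or_gt with hb | hb
    · obtain ⟨c, rfl⟩ : ∃ c, b = -c := ⟨-b, (neg_neg b).symm⟩
      have hc : 0 < c := by linarith
      rw [chatterjeeXi_bandCopula_neg hc, spearmanRho_bandCopula_neg hc] at hm ⊢
      exact ⟨mem_frontier_band hc (by rw [abs_neg, abs_of_pos (spearmanRho_band_pos hc)]) hm,
        chatterjeeXi_band_mem hc⟩
    · rw [bandCopula_of_pos hb] at hm ⊢
      exact ⟨mem_frontier_band hb (abs_of_pos (spearmanRho_band_pos hb)) hm,
        chatterjeeXi_band_mem hb⟩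

theorem eq_bandCopula_of_maxRho {C : ℝ → ℝ → ℝ} (hC : IsCopula C) {x : ℝ}
    (hx : x ∈ Ioo (0 : ℝ) 1) (hxi : chatterjeeXi C = x) (hrho : spearmanRho C = maxRho x) :
    ∀ u ∈ Icc (0 : ℝ) 1, ∀ v ∈ Icc (0 : ℝ) 1, C u v = bandCopula (bParam x) u v := by
  rw [bandCopula_of_pos (bParam_pos hx)]
  exact hC.eq_bandCopulaPos (bParam_pos hx) (hxi.trans (chatterjeeXi_bParam hx).symm)
    (hrho.trans (spearmanRho_bParam hx).symm)

theorem eq_bandCopula_of_neg_maxRho {C : ℝ → ℝ → ℝ} (hC : IsCopula C) {x : ℝ}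
    (hx : x ∈ Ioo (0 : ℝ) 1) (hxi : chatterjeeXi C = x) (hrho : spearmanRho C = -maxRho x) :
    ∀ u ∈ Icc (0 : ℝ) 1, ∀ v ∈ Icc (0 : ℝ) 1, C u v = bandCopula (-bParam x) u v := by
  intro u hu v hv
  have h := eq_bandCopula_of_maxRho (isCopula_reflection hC) hx
    ((chatterjeeXi_reflection hC).trans hxi) (by rw [spearmanRho_reflection hC, hrho, neg_neg])
    (1 - u) ⟨by linarith [hu.2], by linarith [hu.1]⟩ v hv
  rw [bandCopula_of_pos (bParam_pos hx), reflection, sub_sub_cancel] at h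
  rw [bandCopula_neg (bParam_pos hx), reflection, ← h, sub_sub_cancel]

end

theorem theorem1 :
    -- the exact region
    xiRhoRegion = {p : ℝ × ℝ | p.1 ∈ Set.Icc (0 : ℝ) 1 ∧ |p.2| ≤ maxRho p.1} ∧
    -- it is convex
    Convex ℝ xiRhoRegion ∧
    -- its boundary inside the strip `0 < x < 1` is described by the copula family
    (∀ b : ℝ, b ≠ 0 → IsCopula (bandCopula b)) ∧
    frontier xiRhoRegion ∩ {p : ℝ × ℝ | p.1 ∈ Set.Ioo (0 : ℝ) 1} =
      {p : ℝ × ℝ | ∃ b : ℝ, b ≠ 0 ∧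
        p = (chatterjeeXi (bandCopula b), spearmanRho (bandCopula b))} ∧
    -- the extremal copulas are unique
    (∀ x ∈ Set.Ioo (0 : ℝ) 1,
      (IsCopula (bandCopula (bParam x)) ∧
        chatterjeeXi (bandCopula (bParam x)) = x ∧
        spearmanRho (bandCopula (bParam x)) = maxRho x ∧
        ∀ C : ℝ → ℝ → ℝ, IsCopula C → chatterjeeXi C = x → spearmanRho C = maxRho x →
          ∀ u ∈ Set.Icc (0 : ℝ) 1, ∀ v ∈ Set.Icc (0 : ℝ) 1,
            C u v = bandCopula (bParam x) u v) ∧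
      (IsCopula (bandCopula (-bParam x)) ∧
        chatterjeeXi (bandCopula (-bParam x)) = x ∧
        spearmanRho (bandCopula (-bParam x)) = -maxRho x ∧
        ∀ C : ℝ → ℝ → ℝ, IsCopula C → chatterjeeXi C = x → spearmanRho C = -maxRho x →
          ∀ u ∈ Set.Icc (0 : ℝ) 1, ∀ v ∈ Set.Icc (0 : ℝ) 1,
            C u v = bandCopula (-bParam x) u v)) := by
  refine ⟨xiRhoRegion_eq, convex_xiRhoRegion, fun b hb => isCopula_bandCopula hb,
    frontier_xiRhoRegion_inter, fun x hx => ?_⟩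
  have hB := bParam_pos hx
  refine ⟨⟨isCopula_bandCopula hB.ne', ?_, ?_,
      fun C hC h1 h2 => eq_bandCopula_of_maxRho hC hx h1 h2⟩,
    isCopula_bandCopula (neg_neg_of_pos hB).ne, ?_, ?_,
    fun C hC h1 h2 => eq_bandCopula_of_neg_maxRho hC hx h1 h2⟩
  · rw [bandCopula_of_pos hB, chatterjeeXi_bParam hx]
  · rw [bandCopula_of_pos hB, spearmanRho_bParam hx]
  · rw [chatterjeeXi_bandCopula_neg hB, chatterjeeXi_bParam hx]
  · rw [spearmanRho_bandCopula_neg hB, spearmanRho_bParam hx]
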